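/- **Setting.** Let $\Bbbk$ be a field and $n\ge 1$. *Finite side.* Let $\Lambda$ be the preprojective algebra of type $A_{n-1}$ over $\Bbbk$: the path algebra of the double quiver with vertices $1,\dots,n-1$ and arrows $\alpha_v:v\to v+1$, $\alpha_v^*:v+1\to v$ (composed like functions), modulo $\alpha_v^*\alpha_v=\alpha_{v-1}\alpha_{v-1}^*$ for all $v$, where arrows that do not exist are $0$. Let $J$ be its Jacobson radical, $P_i=e_i\Lambda$ the indecomposable projective right module at $i$, and $I_i$ the kernel of a nonzero map from $\Lambda$ to the simple module $S_i$. For $w\in\mathfrak S_n$ and a reduced expression $w=s_{i_1}\cdots s_{i_r}$ in the adjacent transpositions $s_j=(j\ \,j{+}1)$ (permutations are composed like functions), let $I_w=I_{i_1}\cdots I_{i_r}$ (which is $\Lambda$ for the empty expression), and let $I_w^i=I_w\cap P_i$. The *picture of the radical filtration* of $I_w^i$ is the following subset of the plane, with coordinates $(x,y)$. For every composition factor $S_u$ of $P_i$ in the radical layer $P_iJ^d/P_iJ^{d+1}$ that belongs to $I_w^i$ (that is, the image of $I_w^i\cap P_iJ^d$ in this layer has a nonzero component at $u$), take the square $$\bigl\{(x,y):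 |x-\tfrac un|+|y-\tfrac{d+1}n|\le \tfrac1n\bigr\}$$ with its lower boundary $\{\,y\ge\frac{d+1}n,\ |x-\frac un|+|y-\frac{d+1}n|=\frac1n\}$ removed ($y$ increases downwards); the picture is the union of these squares. *Continuous side.* Let $\Lambda_{\mathbb R}$ be the $\Bbbk$-linear category with objects the real numbers, generated by morphisms $\alpha_{yx}:x\to y$ and $\alpha^*_{xy}:y\to x$ for $x<y$, subject to $\alpha_{zy}\alpha_{yx}=\alpha_{zx}$ and $\alpha^*_{xy}\alpha^*_{yz}=\alpha^*_{xz}$ for $x<y<z$, and $\alpha^*_{x+a-b,x+a}\alpha_{x+a,x}=\alpha_{x+a-b,x-b}\alpha^*_{x-b,x}$ for $a,b>0$. Let $\Lambda_{(0,1)}$ be its quotient by the morphisms that are sums of morphisms factoring through points outside $(0,1)$. A morphism of $\Lambda_{(0,1)}$ is *path like* of length $\ell$ if it is a nonzero composition of $\alpha$'s and $\alpha^*$'s of total length $\ell$, where $\alpha_{yx}$ and $\alpha^*_{xy}$ have length $|x-y|$. For $a\in(0,1)$ let $P_a=\mathrm{Hom}_{\Lambda_{(0,1)}}(a,-)$.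 For $f:[0,1]\to\mathbb R$ with $|f(x)-f(y)|\le|x-y|$, $f(0)=a$ and $f(1)=1-a$, let $D_f\subseteq P_a$ be the submodule whose value at $x$ is spanned by the path like morphisms $a\to x$ of length at least $f(x)$. A permuton is a Borel measure $\mu$ on $[0,1]^2$ with $\mu([0,t]\times[0,1])=t=\mu([0,1]\times[0,t])$ for all $t\in[0,1]$; its permuton ideal is $I_\mu=\bigoplus_{a\in(0,1)}I_\mu^a$ with $I_\mu^a=D_{f_{\mu,a}}$, where $f_{\mu,a}(x)=-2\mu([0,x]\times[0,a])+a+x$. The permuton $\gamma_w$ is the sum over $1\le j\le n$ of the uniform measures of total weight $1/n$ on the squares $[\frac{j-1}n,\frac jn]\times[\frac{w(j)-1}n,\frac{w(j)}n]$. The *picture* of a submodule $M\subseteq P_a$ is the set of all $(x,\ell)$ such that $M(x)$ contains a path like morphism of length $\ell$. **Theorem.** For every $w\in\mathfrak S_n$, every reduced expression of $w$ and every $i\in\{1,\dots,n-1\}$, the picture of the summand $I_{\gamma_w}^{i/n}$ of the permuton ideal of $\gamma_w$ equals the picture of the radical filtration of the summand $I_w^i$ of the permutation ideal $I_w$. 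-/

import Mathlib

open CategoryTheory MeasureTheory

/-! ## The preprojective algebra of type `A_m` and its permutation ideals -/

/-- Generators of the preprojective algebra of type `A_m`: the vertex idempotents `e v` and, for
neighbouring vertices `s`, `t = s + 1`, the arrows `α : s → t` and `α* : t → s`.
The vertex called `v` in the usual numbering `1, …, m` is the element `v - 1` of `Fin m`. -/
inductive PreprojGen (m : ℕ) : Type
  | e (v : Fin m) : PreprojGen m
  | α (s t : Fin m) (h : s.val + 1 = t.val) : PreprojGen m
  | αStar (s t : Fin m) (h : s.val + 1 = t.val) : PreprojGen m

namespace PreprojGen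

/-- A generator as an element of the free algebra. -/
noncomputable abbrev free (k : Type*) [Field k] {m : ℕ} (x : PreprojGen m) :
    FreeAlgebra k (PreprojGen m) := FreeAlgebra.ι k x

end PreprojGen

open PreprojGen in
/-- The relations of the preprojective algebra: those of the path algebra of the double quiver
(arrows are composed like functions, from right to left), and `α* α = α α*` at every vertex, where
an arrow that does not exist is read as `0`. -/
inductive PreprojRel (k : Type*) [Field k] (m : ℕ) :
    FreeAlgebra k (PreprojGen m) → FreeAlgebra k (PreprojGen m) → Prop
  | idem (v : Fin m) : PreprojRel k m (free k (e v) * free k (e v)) (free k (e v))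
  | orth (u v : Fin m) (h : u ≠ v) : PreprojRel k m (free k (e u) * free k (e v)) 0
  | one : PreprojRel k m (∑ v : Fin m, free k (e v)) 1
  | arrow (s t : Fin m) (h : s.val + 1 = t.val) :
      PreprojRel k m (free k (e t) * free k (α s t h) * free k (e s)) (free k (α s t h))
  | arrowStar (s t : Fin m) (h : s.val + 1 = t.val) :
      PreprojRel k m (free k (e s) * free k (αStar s t h) * free k (e t)) (free k (αStar s t h))
  | inner (r s t : Fin m) (h : r.val + 1 = s.val) (h' : s.val + 1 = t.val) :
      PreprojRel k m (free k (αStar s t h') * free k (α s t h'))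
        (free k (α r s h) * free k (αStar r s h))
  | first (s t : Fin m) (h : s.val + 1 = t.val) (hs : s.val = 0) :
      PreprojRel k m (free k (αStar s t h) * free k (α s t h)) 0
  | last (s t : Fin m) (h : s.val + 1 = t.val) (ht : t.val + 1 = m) :
      PreprojRel k m (free k (α s t h) * free k (αStar s t h)) 0

/-- The preprojective algebra `Λ` of type `A_m` over the field `k`. -/
abbrev PreprojAlg (k : Type*) [Field k] (m : ℕ) : Type _ := RingQuot (PreprojRel k m)

namespace PreprojAlg

variable (k : Type*) [Field k] {m : ℕ}

/-- The idempotent of `Λ` at the vertex `v`. -/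
noncomputable def idem (v : Fin m) : PreprojAlg k m :=
  RingQuot.mkAlgHom k (PreprojRel k m) (PreprojGen.free k (PreprojGen.e v))

/-- The action of the generators on the simple module `S_v`. -/
def simpleAction (v : Fin m) : PreprojGen m → k
  | PreprojGen.e u => if u = v then 1 else 0
  | PreprojGen.α _ _ _ => 0
  | PreprojGen.αStar _ _ _ => 0

/-- The action of `Λ` on the one-dimensional simple module `S_v`, as an algebra homomorphism. -/
noncomputable def simpleChar (v : Fin m) : PreprojAlg k m →ₐ[k] k :=
  RingQuot.liftAlgHom k (s := PreprojRel k m)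
    ⟨FreeAlgebra.lift k (simpleAction k v), by
      intro x y h
      cases h <;> simp [simpleAction]
      rename_i a b hab
      intro ha hb
      exact hab (hb.trans ha.symm)⟩

/-- The ideal `I_v`: the kernel of a nonzero map `Λ → S_v`, that is, of `x ↦ 1 · x`. -/
noncomputable def vertexIdeal (v : Fin m) : Submodule k (PreprojAlg k m) :=
  LinearMap.ker (simpleChar k v).toLinearMap

/-- The product `I_{v₁} I_{v₂} ⋯ I_{v_r}` for a word `v₁ v₂ … v_r` (all of `Λ` for the empty word).
If the word is a reduced expression `s_{v₁} ⋯ s_{v_r}` of a permutation `w`, this is the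
permutation ideal `I_w`. -/
noncomputable def permutationIdeal : List (Fin m) → Submodule k (PreprojAlg k m)
  | [] => ⊤
  | v :: l => vertexIdeal k v * permutationIdeal l

/-- The indecomposable projective right module `P_v = e_v Λ`. -/
noncomputable def projective (v : Fin m) : Submodule k (PreprojAlg k m) :=
  LinearMap.range (LinearMap.mulLeft k (idem k v))

/-- The Jacobson radical of `Λ`. -/
noncomputable def radical (m : ℕ) : Submodule k (PreprojAlg k m) :=
  (Ring.jacobson (PreprojAlg k m)).restrictScalars k

/-- The radical filtration of `P_v`: its `d`-th term is `P_v J ^ d`, where `J` is the Jacobson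
radical of `Λ`. -/
noncomputable def radicalFiltration (v : Fin m) (d : ℕ) : Submodule k (PreprojAlg k m) :=
  projective k v * radical k m ^ d

/-- The summand of the right ideal `I` contained in `P_v`. -/
noncomputable def summand (I : Submodule k (PreprojAlg k m)) (v : Fin m) :
    Submodule k (PreprojAlg k m) :=
  I ⊓ projective k v

/-- The composition factor `S_u` in the `d`-th radical layer of `P_v` lies in the submodule `N`:
the image of `N ∩ P_v J ^ d` in `P_v J ^ d / P_v J ^ (d + 1)` has a nonzero `u`-component. -/
def HasFactor (N : Submodule k (PreprojAlg k m)) (v u : Fin m) (d : ℕ) : Prop :=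
  ∃ x ∈ N ⊓ radicalFiltration k v d, x * idem k u ∉ radicalFiltration k v (d + 1)

end PreprojAlg

/-- The square, rotated by 45 degrees and with its lower boundary removed, with center `(a, b)` and
half-diagonal `r`. The second coordinate increases downwards. -/
def drawnSquare (a b r : ℝ) : Set (ℝ × ℝ) :=
  {p | |p.1 - a| + |p.2 - b| ≤ r ∧ ¬ (b ≤ p.2 ∧ |p.1 - a| + |p.2 - b| = r)}

/-- The picture of the radical filtration of the summand `I ∩ P_v` of an ideal `I` of the
preprojective algebra of type `A_m`. With `n = m + 1`, a composition factor `S_u` in the `d`-th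
radical layer of `P_v` is drawn as a square with half-diagonal `1 / n`, centered horizontally at
`u / n` (the vertices being numbered from `1`), and the top of the picture of `P_v` is at height `0`.
The squares of the composition factors that belong to `I` are retained. -/
def radicalPicture (k : Type*) [Field k] {m : ℕ} (I : Submodule k (PreprojAlg k m)) (v : Fin m) :
    Set (ℝ × ℝ) :=
  ⋃ (u : Fin m) (d : ℕ) (_ : PreprojAlg.HasFactor k (PreprojAlg.summand k I v) v u d),
    drawnSquare (((u : ℕ) + 1 : ℝ) / (m + 1 : ℕ)) (((d : ℕ) + 1 : ℝ) / (m + 1 : ℕ))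
      (1 / (m + 1 : ℕ))

/-! ## Reduced expressions in the symmetric group -/

/-- The adjacent transposition exchanging `v` and `v + 1`. -/
def adjacentSwap {m : ℕ} (v : Fin m) : Equiv.Perm (Fin (m + 1)) :=
  Equiv.swap v.castSucc v.succ

/-- The word `v₁ … v_r` is a reduced expression of `w`: `w = s_{v₁} ⋯ s_{v_r}` and no shorter word
has this property. -/
def IsReducedExpression {m : ℕ} (word : List (Fin m)) (w : Equiv.Perm (Fin (m + 1))) : Prop :=
  (word.map adjacentSwap).prod = w ∧
    ∀ word' : List (Fin m), (word'.map adjacentSwap).prod = w → word.length ≤ word'.length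

/-- Every permutation has a reduced expression. -/
theorem exists_isReducedExpression {m : ℕ} (w : Equiv.Perm (Fin (m + 1))) :
    ∃ word : List (Fin m), IsReducedExpression word w := by
  have h : ∃ word : List (Fin m), (word.map adjacentSwap).prod = w := by
    have hw : w ∈ Submonoid.closure (Set.range fun i : Fin m => Equiv.swap i.castSucc i.succ) := by
      rw [Equiv.Perm.mclosure_swap_castSucc_succ]; trivial
    induction hw using Submonoid.closure_induction with
    | mem x hx =>
      obtain ⟨i, rfl⟩ := hx
      exact ⟨[i], by simp [adjacentSwap]⟩
    | one => exact ⟨[], rfl⟩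
    | mul x y _ _ hx hy =>
      obtain ⟨a, rfl⟩ := hx
      obtain ⟨b, rfl⟩ := hy
      exact ⟨a ++ b, by simp⟩
  obtain ⟨word, h₁, h₂⟩ := WellFounded.has_min
    (measure (List.length : List (Fin m) → ℕ)).wf
    {l | (l.map adjacentSwap).prod = w} h
  exact ⟨word, h₁, fun l hl => not_lt.mp (h₂ l hl)⟩

/-! ## The continuous preprojective category -/

/-- The points of the real line, as the vertices of a quiver. -/
structure RealVertex where
  /-- The position of the vertex. -/
  pos : ℝ

/-- The generating morphisms: `α x y h : x ⟶ y` and `αStar x y h : y ⟶ x` for all `x < y`. -/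
inductive RealArrow : RealVertex → RealVertex → Type
  | α (x y : ℝ) (h : x < y) : RealArrow ⟨x⟩ ⟨y⟩
  | αStar (x y : ℝ) (h : x < y) : RealArrow ⟨y⟩ ⟨x⟩

instance : Quiver RealVertex := ⟨RealArrow⟩

/-- The length of a path: the sum of the lengths `|x - y|` of its arrows. -/
noncomputable def pathLength {u : RealVertex} : {v : RealVertex} → Quiver.Path u v → ℝ
  | _, Quiver.Path.nil => 0
  | _, Quiver.Path.cons (b := b) (c := c) p _ => pathLength p + |b.pos - c.pos|

/-- The point `x` as an object of the category of paths. -/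
abbrev node (x : ℝ) : Paths RealVertex := (Paths.of RealVertex).obj ⟨x⟩

/-- A composition of `α`'s and `α*`'s from `x` to `y`. -/
abbrev RealPath (x y : ℝ) : Type := node x ⟶ node y

namespace RealPath

/-- The path consisting of one `α`. -/
def α (x y : ℝ) (h : x < y) : RealPath x y :=
  (Paths.of RealVertex).map (RealArrow.α x y h)

/-- The path consisting of one `α*`. -/
def αStar (x y : ℝ) (h : x < y) : RealPath y x :=
  (Paths.of RealVertex).map (RealArrow.αStar x y h)

/-- The length of a composition of `α`'s and `α*`'s. -/
noncomputable def len {x y : ℝ} (p : RealPath x y) : ℝ :=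
  pathLength (u := ⟨x⟩) (v := ⟨y⟩) p

theorem abs_sub_le_len {x y : ℝ} (p : RealPath x y) : |x - y| ≤ len p := by
  have key : ∀ (u v : RealVertex) (p : Quiver.Path u v), |u.pos - v.pos| ≤ pathLength p := by
    intro u v p
    induction p with
    | nil => simp [pathLength]
    | @cons b c p a ih => exact (abs_sub_le u.pos b.pos c.pos).trans (add_le_add_left ih _)
  exact key ⟨x⟩ ⟨y⟩ p

theorem len_comp {x y z : ℝ} (p : RealPath x y) (q : RealPath y z) :
    len (p ≫ q) = len p + len q := by
  have key : ∀ (u v w : RealVertex) (p : Quiver.Path u v) (q : Quiver.Path v w),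
      pathLength (p.comp q) = pathLength p + pathLength q := by
    intro u v w p q
    induction q with
    | nil => simp [pathLength]
    | cons q a ih => simp [pathLength, ih, add_assoc]
  exact key ⟨x⟩ ⟨y⟩ ⟨z⟩ p q

end RealPath

/-- The defining relations of the preprojective category of the real line (`≫` composes from left to
right). In `exchange`, both sides are compositions from `x` to `y` of the same length; one goes first
right to `r` and then left, the other goes first left to `l` and then right. -/
inductive RealRel : HomRel (Paths RealVertex)
  | α_comp (x y z : ℝ) (h : x < y) (h' : y < z) :
      RealRel (RealPath.α x y h ≫ RealPath.α y z h') (RealPath.α x z (h.trans h'))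
  | αStar_comp (x y z : ℝ) (h : x < y) (h' : y < z) :
      RealRel (RealPath.αStar y z h' ≫ RealPath.αStar x y h) (RealPath.αStar x z (h.trans h'))
  | exchange (l x y r : ℝ) (hlx : l < x) (hly : l < y) (hxr : x < r) (hyr : y < r)
      (hsum : l + r = x + y) :
      RealRel (RealPath.α x r hxr ≫ RealPath.αStar y r hyr)
        (RealPath.αStar l x hlx ≫ RealPath.α l y hly)

/-- The preprojective category of the real line, before linearization. -/
abbrev RealPreproj : Type := Quotient RealRel

/-- The `k`-linear preprojective category `Λ_ℝ` of the real line. -/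
abbrev LambdaReal (k : Type*) [Field k] : Type := Free k RealPreproj

namespace LambdaReal

variable (k : Type*) [Field k]

/-- The point `x` as an object of `Λ_ℝ`. -/
noncomputable abbrev pt (x : ℝ) : LambdaReal k :=
  (Free.embedding k RealPreproj).obj ((Quotient.functor RealRel).obj (node x))

/-- The ideal of the morphisms of `Λ_ℝ` that are sums of morphisms factoring through points outside
of `𝕀`. -/
noncomputable def outsideIdeal (𝕀 : Set ℝ) (X Y : LambdaReal k) : Submodule k (X ⟶ Y) :=
  Submodule.span k {f | ∃ z : ℝ, z ∉ 𝕀 ∧ ∃ (g : X ⟶ pt k z) (h : pt k z ⟶ Y), f = g ≫ h}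

/-- Two morphisms of `Λ_ℝ` are identified if their difference is in the ideal. -/
def outsideRel (𝕀 : Set ℝ) : HomRel (LambdaReal k) :=
  fun X Y f g => f - g ∈ outsideIdeal k 𝕀 X Y

variable {k}

theorem comp_mem_outsideIdeal {𝕀 : Set ℝ} {X Y Z : LambdaReal k} {f : X ⟶ Y}
    (hf : f ∈ outsideIdeal k 𝕀 X Y) (g : Y ⟶ Z) : f ≫ g ∈ outsideIdeal k 𝕀 X Z := by
  induction hf using Submodule.span_induction with
  | mem x hx =>
    obtain ⟨z, hz, a, b, rfl⟩ := hx
    exact Submodule.subset_span ⟨z, hz, a, b ≫ g, by simp⟩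
  | zero => simp
  | add x y _ _ hx hy => rw [Preadditive.add_comp]; exact add_mem hx hy
  | smul c x _ hx => rw [Linear.smul_comp]; exact Submodule.smul_mem _ _ hx

theorem mem_outsideIdeal_comp {𝕀 : Set ℝ} {X Y Z : LambdaReal k} (f : X ⟶ Y) {g : Y ⟶ Z}
    (hg : g ∈ outsideIdeal k 𝕀 Y Z) : f ≫ g ∈ outsideIdeal k 𝕀 X Z := by
  induction hg using Submodule.span_induction with
  | mem x hx =>
    obtain ⟨z, hz, a, b, rfl⟩ := hx
    exact Submodule.subset_span ⟨z, hz, f ≫ a, b, by simp⟩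
  | zero => simp
  | add x y _ _ hx hy => rw [Preadditive.comp_add]; exact add_mem hx hy
  | smul c x _ hx => rw [Linear.comp_smul]; exact Submodule.smul_mem _ _ hx

instance (𝕀 : Set ℝ) : Congruence (outsideRel k 𝕀) where
  equivalence :=
    { refl := fun f => by simp [outsideRel]
      symm := fun {f g} h => by
        simpa [outsideRel] using neg_mem (S := Submodule k _) h
      trans := fun {f g h} h₁ h₂ => by
        simpa [outsideRel] using add_mem (S := Submodule k _) h₁ h₂ }
  comp_left := fun {X Y Z} f g g' h => by
    simpa [outsideRel, Preadditive.comp_sub] using mem_outsideIdeal_comp f h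
  comp_right := fun {X Y Z} f f' g h => by
    simpa [outsideRel, Preadditive.sub_comp] using comp_mem_outsideIdeal h g

theorem outsideRel_add (𝕀 : Set ℝ) ⦃X Y : LambdaReal k⦄ (f₁ f₂ g₁ g₂ : X ⟶ Y)
    (hf : outsideRel k 𝕀 f₁ f₂) (hg : outsideRel k 𝕀 g₁ g₂) :
    outsideRel k 𝕀 (f₁ + g₁) (f₂ + g₂) := by
  have := add_mem (S := Submodule k _) hf hg
  rwa [sub_add_sub_comm] at this

theorem outsideRel_smul (𝕀 : Set ℝ) (a : k) ⦃X Y : LambdaReal k⦄ (f₁ f₂ : X ⟶ Y)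
    (hf : outsideRel k 𝕀 f₁ f₂) : outsideRel k 𝕀 (a • f₁) (a • f₂) := by
  have := Submodule.smul_mem _ a hf
  rwa [smul_sub] at this

end LambdaReal

/-- The preprojective category `Λ_𝕀`: the quotient of `Λ_ℝ` in which the points outside of `𝕀`
become zero objects. -/
abbrev LambdaCat (k : Type*) [Field k] (𝕀 : Set ℝ) : Type := Quotient (LambdaReal.outsideRel k 𝕀)

noncomputable instance (k : Type*) [Field k] (𝕀 : Set ℝ) : Preadditive (LambdaCat k 𝕀) :=
  Quotient.preadditive _ (LambdaReal.outsideRel_add 𝕀)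

instance (k : Type*) [Field k] (𝕀 : Set ℝ) :
    (Quotient.functor (LambdaReal.outsideRel k 𝕀)).Additive :=
  Quotient.functor_additive _ (LambdaReal.outsideRel_add 𝕀)

noncomputable instance (k : Type*) [Field k] (𝕀 : Set ℝ) : Linear k (LambdaCat k 𝕀) :=
  Quotient.linear k _ (LambdaReal.outsideRel_smul 𝕀)

namespace LambdaCat

variable (k : Type*) [Field k] (𝕀 : Set ℝ)

/-- The point `x` as an object of `Λ_𝕀`. -/
noncomputable abbrev pt (x : ℝ) : LambdaCat k 𝕀 :=
  (Quotient.functor (LambdaReal.outsideRel k 𝕀)).obj (LambdaReal.pt k x)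

/-- The morphism of `Λ_𝕀` represented by a composition of `α`'s and `α*`'s. -/
noncomputable def ofPath {x y : ℝ} (p : RealPath x y) : pt k 𝕀 x ⟶ pt k 𝕀 y :=
  (Quotient.functor (LambdaReal.outsideRel k 𝕀)).map
    ((Free.embedding k RealPreproj).map ((Quotient.functor RealRel).map p))

theorem ofPath_comp {x y z : ℝ} (p : RealPath x y) (q : RealPath y z) :
    ofPath k 𝕀 (p ≫ q) = ofPath k 𝕀 p ≫ ofPath k 𝕀 q := by
  simp only [ofPath, Functor.map_comp]

variable {k 𝕀}

/-- The morphism `f` is path like of length `ℓ`: it is a nonzero composition of `α`'s and `α*`'s of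
total length `ℓ`. -/
def IsPathLike {x y : ℝ} (f : pt k 𝕀 x ⟶ pt k 𝕀 y) (ℓ : ℝ) : Prop :=
  f ≠ 0 ∧ ∃ p : RealPath x y, ofPath k 𝕀 p = f ∧ RealPath.len p = ℓ

variable (k 𝕀)

/-- A submodule of the representable projective `P_x = Hom(x, -)`. -/
structure Submod (x : ℝ) where
  /-- The value of the submodule at each point. -/
  carrier : ∀ y : ℝ, Submodule k (pt k 𝕀 x ⟶ pt k 𝕀 y)
  comp_mem : ∀ {y z : ℝ} (f : pt k 𝕀 x ⟶ pt k 𝕀 y), f ∈ carrier y →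
    ∀ g : pt k 𝕀 y ⟶ pt k 𝕀 z, f ≫ g ∈ carrier z

/-- The picture of a submodule `M` of `P_x`: the points `(y, ℓ)` such that `M(y)` contains a path
like morphism of length `ℓ`. -/
def Submod.picture {k : Type*} [Field k] {𝕀 : Set ℝ} {x : ℝ} (M : Submod k 𝕀 x) : Set (ℝ × ℝ) :=
  {p | ∃ f ∈ M.carrier p.1, IsPathLike f p.2}

/-! ## Decorous submodules -/

theorem hom_eq_zero_of_notMem {x y : ℝ} (hxy : x ∉ 𝕀 ∨ y ∉ 𝕀) (f : pt k 𝕀 x ⟶ pt k 𝕀 y) :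
    f = 0 := by
  obtain ⟨g, rfl⟩ := (Quotient.functor (LambdaReal.outsideRel k 𝕀)).map_surjective f
  rw [← (Quotient.functor (LambdaReal.outsideRel k 𝕀)).map_zero]
  refine CategoryTheory.Quotient.sound _ ?_
  rw [LambdaReal.outsideRel, sub_zero]
  rcases hxy with h | h
  · exact Submodule.subset_span ⟨x, h, 𝟙 _, g, (Category.id_comp g).symm⟩
  · exact Submodule.subset_span ⟨y, h, g, 𝟙 _, (Category.comp_id g).symm⟩

theorem LambdaReal_hom_mem_span {X Y : RealPreproj}
    (g : (Free.embedding k RealPreproj).obj X ⟶ (Free.embedding k RealPreproj).obj Y) :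
    g ∈ Submodule.span k (Set.range fun q : X ⟶ Y => (Free.embedding k RealPreproj).map q) := by
  have key : ∀ g : (X ⟶ Y) →₀ k,
      g ∈ Submodule.span k (Set.range fun q : X ⟶ Y => Finsupp.single q (1 : k)) := by
    intro g
    have := Finsupp.mem_span_range_iff_exists_finsupp (R := k)
      (v := fun q : X ⟶ Y => Finsupp.single q (1 : k)) (x := g)
    exact this.2 ⟨g, by simp⟩
  exact key g

theorem hom_mem_span {x y : ℝ} (f : pt k 𝕀 x ⟶ pt k 𝕀 y) :
    f ∈ Submodule.span k (Set.range fun p : RealPath x y => ofPath k 𝕀 p) := by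
  obtain ⟨g, rfl⟩ := (Quotient.functor (LambdaReal.outsideRel k 𝕀)).map_surjective f
  have hg := LambdaReal_hom_mem_span k g
  induction hg using Submodule.span_induction with
  | mem g hg =>
    obtain ⟨q, rfl⟩ := hg
    obtain ⟨p, rfl⟩ := (Quotient.functor RealRel).map_surjective q
    exact Submodule.subset_span ⟨p, rfl⟩
  | zero => rw [Functor.map_zero]; exact zero_mem _
  | add a b _ _ ha hb => rw [Functor.map_add]; exact add_mem ha hb
  | smul c a _ ha => exact Submodule.smul_mem _ c ha

end LambdaCat

/-- The set `𝓑_a` of boundary functions: the functions `f : [0, 1] → ℝ` with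
`|f y - f x| ≤ |y - x|`, `f 0 = a` and `f 1 = 1 - a`. (The values outside of `[0, 1]` play no role.) -/
structure IsBoundaryFunction (a : ℝ) (f : ℝ → ℝ) : Prop where
  lipschitz : ∀ x ∈ Set.Icc (0 : ℝ) 1, ∀ y ∈ Set.Icc (0 : ℝ) 1, |f y - f x| ≤ |y - x|
  zero : f 0 = a
  one : f 1 = 1 - a

open LambdaCat in
/-- The decorous submodule `D_f` of `P_a`, over `Λ_(0,1)`, defined by `f ∈ 𝓑_a`: at the point `y` it
is spanned by the path like morphisms whose length is at least `f y`. -/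
noncomputable def decorousSubmod (k : Type*) [Field k] {a : ℝ} {f : ℝ → ℝ}
    (hf : IsBoundaryFunction a f) : Submod k (Set.Ioo 0 1) a where
  carrier y := Submodule.span k {g | ∃ ℓ : ℝ, IsPathLike g ℓ ∧ f y ≤ ℓ}
  comp_mem {y z} g hg h := by
    induction hg using Submodule.span_induction with
    | zero => rw [Limits.zero_comp]; exact zero_mem _
    | add u v _ _ hu hv => rw [Preadditive.add_comp]; exact add_mem hu hv
    | smul c u _ hu => rw [Linear.smul_comp]; exact Submodule.smul_mem _ _ hu
    | mem g hg =>
      have hh := hom_mem_span k _ h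
      induction hh using Submodule.span_induction with
      | zero => rw [Limits.comp_zero]; exact zero_mem _
      | add u v _ _ hu hv => rw [Preadditive.comp_add]; exact add_mem hu hv
      | smul c u _ hu => rw [Linear.comp_smul]; exact Submodule.smul_mem _ _ hu
      | mem h hh =>
        obtain ⟨q, rfl⟩ := hh
        obtain ⟨ℓ, ⟨hg0, p, rfl, rfl⟩, hℓ⟩ := hg
        by_cases h0 : ofPath k (Set.Ioo 0 1) p ≫ ofPath k (Set.Ioo 0 1) q = 0
        · exact h0 ▸ zero_mem _
        · have hy : y ∈ Set.Ioo (0 : ℝ) 1 := by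
            by_contra hy
            exact hg0 (hom_eq_zero_of_notMem k _ (Or.inr hy) _)
          have hz : z ∈ Set.Ioo (0 : ℝ) 1 := by
            by_contra hz
            exact h0 (hom_eq_zero_of_notMem k _ (Or.inr hz) _)
          refine Submodule.subset_span ⟨RealPath.len p + RealPath.len q,
            ⟨h0, p ≫ q, ofPath_comp k _ p q, RealPath.len_comp p q⟩, ?_⟩
          · have h₁ := hf.lipschitz y (Set.Ioo_subset_Icc_self hy) z (Set.Ioo_subset_Icc_self hz)
            have h₂ := RealPath.abs_sub_le_len q
            rw [abs_sub_comm] at h₂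
            linarith [le_abs_self (f z - f y)]

/-! ## Permutons and permuton ideals -/

/-- A permuton: a Borel measure on the unit square with
`μ ([0, t] × [0, 1]) = t = μ ([0, 1] × [0, t])`. -/
structure Permuton where
  /-- The underlying measure. -/
  measure : Measure (unitInterval × unitInterval)
  left : ∀ t : unitInterval, measure (Set.Icc 0 t ×ˢ Set.univ) = ENNReal.ofReal t
  right : ∀ t : unitInterval, measure (Set.univ ×ˢ Set.Icc 0 t) = ENNReal.ofReal t

namespace Permuton

/-- The rectangle `[0, x] × [0, y]`, as a subset of the unit square. -/
def corner (x y : ℝ) : Set (unitInterval × unitInterval) :=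
  {p | (p.1 : ℝ) ≤ x ∧ (p.2 : ℝ) ≤ y}

/-- The function `f_{μ,y}(x) = -2 μ ([0, x] × [0, y]) + y + x`. -/
noncomputable def boundary (μ : Permuton) (y x : ℝ) : ℝ :=
  -2 * μ.measure.real (corner x y) + y + x

theorem isBoundaryFunction (μ : Permuton) {a : ℝ} (ha : a ∈ Set.Ioo (0 : ℝ) 1) :
    IsBoundaryFunction a (μ.boundary a) := by
  have huniv : μ.measure Set.univ = 1 := by
    have h := μ.left 1
    have h1 : (Set.Icc (0 : unitInterval) 1) = Set.univ := Set.Icc_bot_top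
    rw [h1, Set.univ_prod_univ] at h
    simpa using h
  have : IsProbabilityMeasure μ.measure := ⟨huniv⟩
  have hmono : ∀ x ∈ Set.Icc (0 : ℝ) 1, ∀ y ∈ Set.Icc (0 : ℝ) 1, x ≤ y →
      μ.measure.real (corner x a) ≤ μ.measure.real (corner y a) ∧
      μ.measure.real (corner y a) ≤ μ.measure.real (corner x a) + (y - x) := by
    intro x hx y hy hxy
    refine ⟨measureReal_mono fun p hp => ⟨hp.1.trans hxy, hp.2⟩, ?_⟩
    have hl : ∀ t (ht : t ∈ Set.Icc (0 : ℝ) 1),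
        μ.measure.real (Set.Icc (0 : unitInterval) ⟨t, ht⟩ ×ˢ Set.univ) = t := by
      intro t ht
      rw [measureReal_def, μ.left, ENNReal.toReal_ofReal ht.1]
    have hsub : Set.Icc (0 : unitInterval) ⟨x, hx⟩ ×ˢ (Set.univ : Set unitInterval) ⊆
        Set.Icc (0 : unitInterval) ⟨y, hy⟩ ×ˢ Set.univ :=
      Set.prod_mono (Set.Icc_subset_Icc_right hxy) subset_rfl
    have hdiff := measureReal_sdiff (μ := μ.measure) hsub
      (measurableSet_Icc.prod MeasurableSet.univ)
    rw [hl, hl] at hdiff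
    rw [← hdiff]
    refine (measureReal_mono ?_).trans (measureReal_union_le _ _)
    intro p hp
    by_cases hpx : (p.1 : ℝ) ≤ x
    · exact Or.inl ⟨hpx, hp.2⟩
    · refine Or.inr ⟨⟨⟨p.1.2.1, hp.1⟩, trivial⟩, fun h => hpx h.1.2⟩
  refine ⟨?_, ?_, ?_⟩
  · intro x hx y hy
    rcases le_total x y with h | h
    · have := hmono x hx y hy h
      rw [abs_of_nonneg (sub_nonneg.2 h), abs_le, boundary, boundary]
      constructor <;> linarith
    · have := hmono y hy x hx h
      rw [abs_of_nonpos (sub_nonpos.2 h), abs_le, boundary, boundary]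
      constructor <;> linarith
  · have h : μ.measure.real (corner 0 a) = 0 := by
      have h0 := μ.left 0
      rw [measureReal_def, measure_mono_null (t := Set.Icc (0 : unitInterval) 0 ×ˢ Set.univ) _
        (by rw [h0]; simp)]
      · simp
      · intro p hp
        exact ⟨⟨p.1.2.1, hp.1⟩, trivial⟩
    rw [boundary, h]; ring
  · have h : μ.measure.real (corner 1 a) = a := by
      have h0 := μ.right ⟨a, ha.1.le, ha.2.le⟩
      have h1 : corner 1 a = Set.univ ×ˢ Set.Icc (0 : unitInterval) ⟨a, ha.1.le, ha.2.le⟩ := by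
        ext p
        exact ⟨fun hp => ⟨trivial, p.2.2.1, hp.2⟩, fun hp => ⟨p.1.2.2, hp.2.2⟩⟩
      rw [h1, measureReal_def, h0, ENNReal.toReal_ofReal ha.1.le]
    rw [boundary, h]; ring

/-- The permuton ideal `I_μ = ⨁_a D_{f_{μ,a}}`, given by its summands `I_μ ^ a ⊆ P_a` for
`a ∈ (0, 1)`. -/
noncomputable def ideal (k : Type*) [Field k] (μ : Permuton) (a : Set.Ioo (0 : ℝ) 1) :
    LambdaCat.Submod k (Set.Ioo 0 1) (a : ℝ) :=
  decorousSubmod k (μ.isBoundaryFunction a.2)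

/-- The `j`-th of `n` equal subintervals `[j / n, (j + 1) / n]` of `[0, 1]`, where `0 ≤ j < n`. -/
def strip (n : ℕ) (j : Fin n) : Set unitInterval :=
  {t | (j : ℕ) / (n : ℝ) ≤ t ∧ (t : ℝ) ≤ ((j : ℕ) + 1) / (n : ℝ)}

/-- The measure of `γ_w`: the sum over `i` of the uniform measures of weight `1 / n` on the squares
`(i, w i)` of side `1 / n`, that is, of `n` times the area. -/
noncomputable def ofPermMeasure {n : ℕ} (w : Equiv.Perm (Fin n)) :
    Measure (unitInterval × unitInterval) :=
  ∑ i : Fin n, (n : ENNReal) • (volume.restrict (strip n i ×ˢ strip n (w i)))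

theorem measurableSet_strip {n : ℕ} (j : Fin n) : MeasurableSet (strip n j) :=
  (measurableSet_le measurable_const measurable_subtype_coe).inter
    (measurableSet_le measurable_subtype_coe measurable_const)

theorem volume_strip_inter {n : ℕ} (j : Fin n) (t : unitInterval) :
    volume (Set.Icc 0 t ∩ strip n j) =
      ENNReal.ofReal (min (t : ℝ) (((j : ℕ) + 1 : ℕ) / (n : ℝ)) -
        min (t : ℝ) (((j : ℕ) : ℝ) / (n : ℝ))) := by
  have h0 : (0 : ℝ) ≤ ((j : ℕ) : ℝ) / (n : ℝ) := by positivity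
  have himg : Subtype.val '' (Set.Icc 0 t ∩ strip n j) =
      Set.Icc (((j : ℕ) : ℝ) / (n : ℝ)) (min (t : ℝ) (((j : ℕ) + 1 : ℕ) / (n : ℝ))) := by
    ext x
    constructor
    · rintro ⟨y, ⟨hy, hy'⟩, rfl⟩
      exact ⟨hy'.1, le_min hy.2 (by have := hy'.2; push_cast; exact this)⟩
    · rintro ⟨h₁, h₂⟩
      have h₃ := h₂.trans (min_le_left _ _)
      refine ⟨⟨x, h0.trans h₁, h₃.trans t.2.2⟩, ⟨⟨h0.trans h₁, h₃⟩, h₁, ?_⟩, rfl⟩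
      have h₄ := h₂.trans (min_le_right _ _)
      push_cast at h₄
      exact h₄
  rw [unitInterval.volume_apply, himg, Real.volume_Icc]
  rcases le_total (t : ℝ) (((j : ℕ) : ℝ) / (n : ℝ)) with h | h
  · have h' : (t : ℝ) ≤ ((j : ℕ) + 1 : ℕ) / (n : ℝ) := h.trans (by gcongr; omega)
    rw [min_eq_left h, min_eq_left h', sub_self, ENNReal.ofReal_zero,
      ENNReal.ofReal_eq_zero.2 (sub_nonpos.2 h)]
  · rw [min_eq_right h]

theorem volume_strip {n : ℕ} (j : Fin n) : volume (strip n j) = (n : ENNReal)⁻¹ := by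
  have hn : (0 : ℝ) < n := by exact_mod_cast j.pos
  have h := volume_strip_inter j 1
  have h1 : (Set.Icc (0 : unitInterval) 1) = Set.univ := Set.Icc_bot_top
  have hj : (((j : ℕ) + 1 : ℕ) : ℝ) / n ≤ 1 := by
    rw [div_le_one hn]; exact_mod_cast j.2
  have hj' : ((j : ℕ) : ℝ) / n ≤ 1 := by
    rw [div_le_one hn]; exact_mod_cast j.2.le
  rw [h1, Set.univ_inter, Set.Icc.coe_one, min_eq_right hj, min_eq_right hj', ← sub_div] at h
  rw [h]
  push_cast
  rw [add_sub_cancel_left, one_div, ENNReal.ofReal_inv_of_pos hn, ENNReal.ofReal_natCast]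

theorem sum_volume_strip {n : ℕ} [NeZero n] (t : unitInterval) :
    ∑ j : Fin n, volume (Set.Icc 0 t ∩ strip n j) = ENNReal.ofReal t := by
  have hn : (n : ℝ) ≠ 0 := Nat.cast_ne_zero.2 (NeZero.ne n)
  simp_rw [volume_strip_inter]
  rw [← ENNReal.ofReal_sum_of_nonneg]
  · rw [Fin.sum_univ_eq_sum_range (fun j : ℕ => min (t : ℝ) ((j + 1 : ℕ) / (n : ℝ)) -
      min (t : ℝ) ((j : ℝ) / (n : ℝ))),
      Finset.sum_range_sub (fun j : ℕ => min (t : ℝ) ((j : ℝ) / (n : ℝ)))]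
    rw [div_self hn, min_eq_left t.2.2]
    simp [t.2.1]
  · intro j _
    rw [sub_nonneg]
    gcongr
    omega

/-- The permuton `γ_w` of a permutation `w` of `n ≥ 1` elements. -/
noncomputable def ofPerm {n : ℕ} [NeZero n] (w : Equiv.Perm (Fin n)) : Permuton where
  measure := ofPermMeasure w
  left t := by
    rw [ofPermMeasure, Measure.finsetSum_apply, ← sum_volume_strip (n := n) t]
    refine Finset.sum_congr rfl fun j _ => ?_
    rw [Measure.smul_apply, Measure.restrict_apply (measurableSet_Icc.prod MeasurableSet.univ),
      Set.prod_inter_prod, Set.univ_inter, Measure.volume_eq_prod, Measure.prod_prod,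
      volume_strip, smul_eq_mul, mul_left_comm,
      ENNReal.mul_inv_cancel (by simp [NeZero.ne n]) (by simp), mul_one]
  right t := by
    rw [ofPermMeasure, Measure.finsetSum_apply, ← sum_volume_strip (n := n) t,
      ← Equiv.sum_comp w fun j => volume (Set.Icc 0 t ∩ strip n j)]
    refine Finset.sum_congr rfl fun j _ => ?_
    rw [Measure.smul_apply, Measure.restrict_apply (MeasurableSet.univ.prod measurableSet_Icc),
      Set.prod_inter_prod, Set.univ_inter, Measure.volume_eq_prod, Measure.prod_prod,
      volume_strip, smul_eq_mul, ← mul_assoc,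
      ENNReal.mul_inv_cancel (by simp [NeZero.ne n]) (by simp), one_mul]

end Permuton

/-- The point `v / n` of `(0, 1)` for a vertex `v` of the Dynkin diagram of type `A_m`, where
`n = m + 1` and the vertices are numbered from `1`. -/
noncomputable def vertexPoint {m : ℕ} (v : Fin m) : Set.Ioo (0 : ℝ) 1 :=
  ⟨((v : ℕ) + 1 : ℝ) / (m + 1 : ℕ), by
    have := v.2
    constructor
    · positivity
    · rw [div_lt_one (by positivity)]
      exact_mod_cast (by omega : (v : ℕ) + 1 < m + 1)⟩

/-! Both pictures are explicit regions cut out by one boundary function, and they are compared after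
scaling by `n = m + 1`.

Finite side. The sum `left` of all `α*` commutes with the sum `right` of all `α`, so `Λ` is spanned
by the paths `path u a b`, and the nonzero ones are linearly independent, by an explicit
representation. All the subspaces involved are spanned by paths. The Jacobson radical is spanned by
the paths of positive length, so `P_v J ^ d` is spanned by the paths of length at least `d` ending
at `v`. By induction on a reduced word, `I_w` is spanned by the paths from `u` to `v` with `u + 1 ≤
a + c`, where `c = cornerCount w (v + 1) (u + 1)` (`permutationIdeal_eq`). As `v + a = u + b`, this
says that the length `a + b` is at least `(v + 1) + (u + 1) - 2c`.

Continuous side. Modulo the relations a path from `x` to `y` is determined by its length. It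
survives in `Λ_(0,1)` exactly if its length is less than `x + y` and less than `2 - x - y`, and path
like morphisms of different lengths are independent. Hence the picture of `D_f` is the part of this
region on or below the graph of `f`, the second coordinate increasing downwards
(`picture_decorousSubmod`).

Comparison. For `γ_w` the scaled boundary function takes the value `(v + 1) + (u + 1) - 2c` at the
grid point of `u`, which is the finite threshold. Its parity is that of the path lengths from `u` to
`v`. By this and the Lipschitz condition, each half-open square lies entirely on or below the graph,
or entirely above it; these squares tile the picture of `P_a`. -/

namespace PreprojAlg

/-! ### Paths span the preprojective algebra. -/

section Basis

variable (k : Type*) [Field k] {m : ℕ}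

/-- The image of a generator in the preprojective algebra. -/
noncomputable def gen (x : PreprojGen m) : PreprojAlg k m :=
  RingQuot.mkAlgHom k (PreprojRel k m) (PreprojGen.free k x)

theorem idem_eq_gen (v : Fin m) : idem k v = gen k (.e v) := rfl

theorem idem_mul_self (v : Fin m) : idem k v * idem k v = idem k v := by
  simpa only [map_mul, idem_eq_gen, gen] using RingQuot.mkAlgHom_rel k (PreprojRel.idem (k := k) v)

theorem idem_mul_of_ne {u v : Fin m} (h : u ≠ v) : idem k u * idem k v = 0 := by
  simpa only [map_mul, map_zero, idem_eq_gen, gen] using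
    RingQuot.mkAlgHom_rel k (PreprojRel.orth (k := k) u v h)

theorem sum_idem : ∑ v : Fin m, idem k v = 1 := by
  simpa only [map_sum, map_one, idem_eq_gen, gen] using
    RingQuot.mkAlgHom_rel k (PreprojRel.one (k := k) (m := m))

theorem idem_mul_α {s t : Fin m} (h : s.val + 1 = t.val) :
    idem k t * gen k (.α s t h) = gen k (.α s t h) := by
  have := RingQuot.mkAlgHom_rel k (PreprojRel.arrow (k := k) s t h)
  simp only [map_mul] at this
  change idem k t * gen k (.α s t h) * idem k s = gen k (.α s t h) at this
  rw [← this, ← mul_assoc, ← mul_assoc, idem_mul_self]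

theorem α_mul_idem {s t : Fin m} (h : s.val + 1 = t.val) :
    gen k (.α s t h) * idem k s = gen k (.α s t h) := by
  have := RingQuot.mkAlgHom_rel k (PreprojRel.arrow (k := k) s t h)
  simp only [map_mul] at this
  change idem k t * gen k (.α s t h) * idem k s = gen k (.α s t h) at this
  rw [← this, mul_assoc, idem_mul_self]

theorem idem_mul_αStar {s t : Fin m} (h : s.val + 1 = t.val) :
    idem k s * gen k (.αStar s t h) = gen k (.αStar s t h) := by
  have := RingQuot.mkAlgHom_rel k (PreprojRel.arrowStar (k := k) s t h)
  simp only [map_mul] at this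
  change idem k s * gen k (.αStar s t h) * idem k t = gen k (.αStar s t h) at this
  rw [← this, ← mul_assoc, ← mul_assoc, idem_mul_self]

theorem αStar_mul_idem {s t : Fin m} (h : s.val + 1 = t.val) :
    gen k (.αStar s t h) * idem k t = gen k (.αStar s t h) := by
  have := RingQuot.mkAlgHom_rel k (PreprojRel.arrowStar (k := k) s t h)
  simp only [map_mul] at this
  change idem k s * gen k (.αStar s t h) * idem k t = gen k (.αStar s t h) at this
  rw [← this, mul_assoc, idem_mul_self]

theorem αStar_mul_α {r s t : Fin m} (h : r.val + 1 = s.val) (h' : s.val + 1 = t.val) :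
    gen k (.αStar s t h') * gen k (.α s t h') = gen k (.α r s h) * gen k (.αStar r s h) := by
  simpa only [map_mul, idem_eq_gen, gen] using
    RingQuot.mkAlgHom_rel k (PreprojRel.inner (k := k) r s t h h')

theorem αStar_mul_α_first {s t : Fin m} (h : s.val + 1 = t.val) (hs : s.val = 0) :
    gen k (.αStar s t h) * gen k (.α s t h) = 0 := by
  simpa only [map_mul, map_zero, idem_eq_gen, gen] using
    RingQuot.mkAlgHom_rel k (PreprojRel.first (k := k) s t h hs)

theorem α_mul_αStar_last {s t : Fin m} (h : s.val + 1 = t.val) (ht : t.val + 1 = m) :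
    gen k (.α s t h) * gen k (.αStar s t h) = 0 := by
  simpa only [map_mul, map_zero, idem_eq_gen, gen] using
    RingQuot.mkAlgHom_rel k (PreprojRel.last (k := k) s t h ht)

variable (m) in
/-- The sum of all arrows `α`. -/
noncomputable def right : PreprojAlg k m :=
  ∑ s : Fin m, ∑ t : Fin m, if h : s.val + 1 = t.val then gen k (.α s t h) else 0

variable (m) in
/-- The sum of all arrows `α*`. -/
noncomputable def left : PreprojAlg k m :=
  ∑ t : Fin m, ∑ s : Fin m, if h : s.val + 1 = t.val then gen k (.αStar s t h) else 0

theorem right_mul_idem_eq_sum (s : Fin m) : right k m * idem k s =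
    ∑ t : Fin m, if h : s.val + 1 = t.val then gen k (.α s t h) else 0 := by
  rw [right, Finset.sum_mul, Finset.sum_eq_single s]
  · rw [Finset.sum_mul]
    refine Finset.sum_congr rfl fun t _ => ?_
    split_ifs with h
    · exact α_mul_idem k h
    · exact zero_mul _
  · intro s' _ hs'
    rw [Finset.sum_mul]
    refine Finset.sum_eq_zero fun t _ => ?_
    split_ifs with h
    · rw [← α_mul_idem, mul_assoc, idem_mul_of_ne k hs', mul_zero]
    · exact zero_mul _
  · simp

theorem left_mul_idem_eq_sum (t : Fin m) : left k m * idem k t =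
    ∑ s : Fin m, if h : s.val + 1 = t.val then gen k (.αStar s t h) else 0 := by
  rw [left, Finset.sum_mul, Finset.sum_eq_single t]
  · rw [Finset.sum_mul]
    refine Finset.sum_congr rfl fun t _ => ?_
    split_ifs with h
    · exact αStar_mul_idem k h
    · exact zero_mul _
  · intro t' _ ht'
    rw [Finset.sum_mul]
    refine Finset.sum_eq_zero fun s _ => ?_
    split_ifs with h
    · rw [← αStar_mul_idem, mul_assoc, idem_mul_of_ne k ht', mul_zero]
    · exact zero_mul _
  · simp

theorem right_mul_idem {s t : Fin m} (h : s.val + 1 = t.val) :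
    right k m * idem k s = gen k (.α s t h) := by
  rw [right_mul_idem_eq_sum, Finset.sum_eq_single t, dif_pos h]
  · exact fun t' _ ht' => dif_neg fun h' => ht' (Fin.ext (h'.symm.trans h))
  · simp

theorem right_mul_idem_last {s : Fin m} (hs : s.val + 1 = m) : right k m * idem k s = 0 := by
  rw [right_mul_idem_eq_sum]
  exact Finset.sum_eq_zero fun t _ => dif_neg fun h => by omega

theorem left_mul_idem {s t : Fin m} (h : s.val + 1 = t.val) :
    left k m * idem k t = gen k (.αStar s t h) := by
  rw [left_mul_idem_eq_sum, Finset.sum_eq_single s, dif_pos h]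
  · exact fun s' _ hs' => dif_neg fun h' => hs' (Fin.ext (by omega))
  · simp

theorem left_mul_idem_first {t : Fin m} (ht : t.val = 0) : left k m * idem k t = 0 := by
  rw [left_mul_idem_eq_sum]
  exact Finset.sum_eq_zero fun s _ => dif_neg fun h => by omega

/-- At an inner vertex this is the preprojective relation. At an end vertex one side contains an
arrow that does not exist, and the relation makes the other side vanish as well. -/
theorem left_right_mul_idem (s : Fin m) :
    left k m * (right k m * idem k s) = right k m * (left k m * idem k s) := by
  have key : ∀ t : Fin m, ∀ h : s.val + 1 = t.val, left k m * (right k m * idem k s) =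
      gen k (.αStar s t h) * gen k (.α s t h) := by
    intro t h
    rw [right_mul_idem k h, ← left_mul_idem k h, mul_assoc, idem_mul_α]
  have key' : ∀ r : Fin m, ∀ h : r.val + 1 = s.val, right k m * (left k m * idem k s) =
      gen k (.α r s h) * gen k (.αStar r s h) := by
    intro r h
    rw [left_mul_idem k h, ← right_mul_idem k h, mul_assoc, idem_mul_αStar]
  rcases Nat.eq_zero_or_pos s.val with hs | hs
  · rw [left_mul_idem_first k hs, mul_zero]
    by_cases hs' : s.val + 1 = m
    · rw [right_mul_idem_last k hs', mul_zero]
    · have h : s.val + 1 = (⟨s.val + 1, by omega⟩ : Fin m).val := rfl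
      rw [key _ h, αStar_mul_α_first k h hs]
  · have h : (⟨s.val - 1, by omega⟩ : Fin m).val + 1 = s.val := Nat.sub_add_cancel hs
    rw [key' _ h]
    by_cases hs' : s.val + 1 = m
    · rw [right_mul_idem_last k hs', mul_zero, α_mul_αStar_last k h hs']
    · have h' : s.val + 1 = (⟨s.val + 1, by omega⟩ : Fin m).val := rfl
      rw [key _ h', αStar_mul_α k h h']

theorem commute_left_right : Commute (left k m) (right k m) := by
  rw [Commute, SemiconjBy, ← mul_one (left k m * _), ← mul_one (right k m * _), ← sum_idem k,
    Finset.mul_sum, Finset.mul_sum]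
  exact Finset.sum_congr rfl fun s _ => by rw [mul_assoc, mul_assoc, left_right_mul_idem]

/-- The path that starts at `u` and makes `a` steps to the left, then `b` steps to the right. -/
noncomputable def path (u : Fin m) (a b : ℕ) : PreprojAlg k m :=
  right k m ^ b * left k m ^ a * idem k u

theorem path_zero_zero (u : Fin m) : path k u 0 0 = idem k u := by simp [path]

theorem right_mul_path (u : Fin m) (a b : ℕ) :
    right k m * path k u a b = path k u a (b + 1) := by
  simp only [path, pow_succ', mul_assoc]

theorem left_mul_path (u : Fin m) (a b : ℕ) :
    left k m * path k u a b = path k u (a + 1) b := by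
  rw [path, path, pow_succ', ← mul_assoc, ← mul_assoc, ← mul_assoc,
    ((commute_left_right k).pow_right b).eq]

theorem pow_mul_path (u : Fin m) (a b a' b' : ℕ) :
    right k m ^ b * left k m ^ a * path k u a' b' = path k u (a + a') (b + b') := by
  rw [path, path, pow_add, pow_add, ← mul_assoc, ← mul_assoc]
  congr 1
  rw [mul_assoc (right k m ^ b), ((commute_left_right k).pow_pow a b').eq]
  simp only [mul_assoc]

theorem path_mul_idem (u : Fin m) (a b : ℕ) : path k u a b * idem k u = path k u a b := by
  rw [path, mul_assoc, idem_mul_self]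

theorem path_mul_idem_of_ne {u v : Fin m} (h : u ≠ v) (a b : ℕ) :
    path k u a b * idem k v = 0 := by
  rw [path, mul_assoc, idem_mul_of_ne k h, mul_zero]

/-- Each step moves to the neighbouring vertex or, at an end of the diagram, gives `0`. The endpoint
is recorded by an additive equation to avoid truncated subtraction. -/
theorem path_eq_zero_or (u : Fin m) (a b : ℕ) :
    path k u a b = 0 ∨ ∃ v : Fin m, v.val + a = u.val + b ∧
      idem k v * path k u a b = path k u a b := by
  induction b with
  | zero =>
    induction a with
    | zero => exact Or.inr ⟨u, rfl, by rw [path_zero_zero, idem_mul_self]⟩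
    | succ a ih =>
      rw [← left_mul_path]
      rcases ih with h | ⟨v, hv, h⟩
      · rw [h, mul_zero]; exact Or.inl rfl
      · rw [← h, ← mul_assoc]
        rcases Nat.eq_zero_or_pos v.val with h0 | h0
        · rw [left_mul_idem_first k h0, zero_mul]; exact Or.inl rfl
        · have h1 : (⟨v.val - 1, by omega⟩ : Fin m).val + 1 = v.val := Nat.sub_add_cancel h0
          refine Or.inr ⟨⟨v.val - 1, by omega⟩, by simp only; omega, ?_⟩
          rw [left_mul_idem k h1, ← mul_assoc, idem_mul_αStar]
  | succ b ih =>
    rw [← right_mul_path]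
    rcases ih with h | ⟨v, hv, h⟩
    · rw [h, mul_zero]; exact Or.inl rfl
    · rw [← h, ← mul_assoc]
      by_cases h0 : v.val + 1 = m
      · rw [right_mul_idem_last k h0, zero_mul]; exact Or.inl rfl
      · have h1 : v.val + 1 = (⟨v.val + 1, by omega⟩ : Fin m).val := rfl
        refine Or.inr ⟨⟨v.val + 1, by omega⟩, by simp only; omega, ?_⟩
        rw [right_mul_idem k h1, ← mul_assoc, idem_mul_α]

theorem idem_mul_path (v u : Fin m) (a b : ℕ) :
    idem k v * path k u a b = if v.val + a = u.val + b then path k u a b else 0 := by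
  rcases path_eq_zero_or k u a b with h | ⟨t, ht, h⟩
  · simp [h]
  · split_ifs with hv
    · rwa [show v = t from Fin.ext (by omega)]
    · rw [← h, ← mul_assoc, idem_mul_of_ne, zero_mul]
      rintro rfl
      exact hv ht

theorem path_mul_path (u u' : Fin m) (a b a' b' : ℕ) :
    path k u a b * path k u' a' b' =
      if u.val + a' = u'.val + b' then path k u' (a + a') (b + b') else 0 := by
  rw [path, mul_assoc, idem_mul_path]
  split_ifs
  · exact pow_mul_path ..
  · exact mul_zero _

theorem exists_target {u : Fin m} {a b : ℕ} (h : path k u a b ≠ 0) :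
    ∃ v : Fin m, v.val + a = u.val + b :=
  ((path_eq_zero_or k u a b).resolve_left h).imp fun _ => And.left

/-- The left steps alone already leave the diagram, whatever follows. -/
theorem path_eq_zero_of_lt_left {u : Fin m} {a : ℕ} (h : u.val < a) (b : ℕ) :
    path k u a b = 0 := by
  have h0 : path k u a 0 = 0 := by
    by_contra h0
    obtain ⟨v, hv⟩ := exists_target k h0
    omega
  have := pow_mul_path k u 0 b a 0
  rwa [h0, mul_zero, zero_add, add_zero, eq_comm] at this

/-- By commutation the right steps may be made first, and they leave the diagram on their own. -/
theorem path_eq_zero_of_le_right {u : Fin m} {b : ℕ} (h : m ≤ u.val + b) (a : ℕ) :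
    path k u a b = 0 := by
  have h0 : path k u 0 b = 0 := by
    by_contra h0
    obtain ⟨v, hv⟩ := exists_target k h0
    omega
  have := pow_mul_path k u a 0 0 b
  rwa [h0, mul_zero, zero_add, add_zero, eq_comm] at this

/-- The span of the paths that satisfy a condition. -/
noncomputable def pathSpan (P : Fin m → ℕ → ℕ → Prop) : Submodule k (PreprojAlg k m) :=
  Submodule.span k {x | ∃ u a b, P u a b ∧ path k u a b = x}

variable {k} in
theorem path_mem_pathSpan {P : Fin m → ℕ → ℕ → Prop} {u : Fin m} {a b : ℕ} (h : P u a b) :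
    path k u a b ∈ pathSpan k P :=
  Submodule.subset_span ⟨u, a, b, h, rfl⟩

variable {k} in
theorem pathSpan_le {P : Fin m → ℕ → ℕ → Prop} {S : Submodule k (PreprojAlg k m)}
    (h : ∀ u a b, P u a b → path k u a b ∈ S) : pathSpan k P ≤ S := by
  rw [pathSpan, Submodule.span_le]
  rintro _ ⟨u, a, b, hP, rfl⟩
  exact h u a b hP

theorem pathSpan_mul_le {P Q : Fin m → ℕ → ℕ → Prop} {S : Submodule k (PreprojAlg k m)}
    (h : ∀ u a b u' a' b', P u a b → Q u' a' b' → u.val + a' = u'.val + b' →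
      path k u' (a + a') (b + b') ∈ S) : pathSpan k P * pathSpan k Q ≤ S := by
  rw [pathSpan, pathSpan, Submodule.span_mul_span, Submodule.span_le]
  rintro _ ⟨_, ⟨u, a, b, hP, rfl⟩, _, ⟨u', a', b', hQ, rfl⟩, rfl⟩
  change path k u a b * path k u' a' b' ∈ S
  rw [path_mul_path]
  split_ifs with h0
  · exact h u a b u' a' b' hP hQ h0
  · exact zero_mem _

theorem pathSpan_true : pathSpan k (fun (_ : Fin m) _ _ => True) = ⊤ := by
  rw [eq_top_iff]
  rintro x -
  obtain ⟨y, rfl⟩ := RingQuot.mkAlgHom_surjective k (PreprojRel k m) x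
  have hone : (1 : PreprojAlg k m) ∈ pathSpan k (fun (_ : Fin m) _ _ => True) := by
    rw [← sum_idem k]
    refine sum_mem fun v _ => ?_
    rw [← path_zero_zero]
    exact path_mem_pathSpan trivial
  induction y using FreeAlgebra.induction with
  | grade0 r =>
    rw [AlgHom.commutes, Algebra.algebraMap_eq_smul_one]
    exact Submodule.smul_mem _ _ hone
  | grade1 x =>
    change gen k x ∈ _
    cases x with
    | e v =>
      rw [← idem_eq_gen, ← path_zero_zero]
      exact path_mem_pathSpan trivial
    | α s t h =>
      rw [← right_mul_idem k h, ← path_zero_zero, right_mul_path]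
      exact path_mem_pathSpan trivial
    | αStar s t h =>
      rw [← left_mul_idem k h, ← path_zero_zero, left_mul_path]
      exact path_mem_pathSpan trivial
  | mul a b ha hb =>
    rw [map_mul]
    exact pathSpan_mul_le k (fun _ _ _ _ _ _ _ _ _ => path_mem_pathSpan trivial)
      (Submodule.mul_mem_mul ha hb)
  | add a b ha hb => rw [map_add]; exact add_mem ha hb

end Basis

/-! ### Linear independence of the nonzero paths. -/

section Coefficient

variable (k : Type*) [Field k] {m : ℕ}

/-- The pairs `(a, b)` such that the path from `u` with `a` steps to the left and `b` steps to the
right is nonzero. -/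
abbrev PathIndex (u : Fin m) : Type := {p : ℕ × ℕ // p.1 ≤ u.val ∧ p.2 + u.val < m}

/-- The linear map that acts on a basis by a partial map. -/
noncomputable def partialMap {X : Type*} (f : X → Option X) : (X →₀ k) →ₗ[k] (X →₀ k) :=
  Finsupp.linearCombination k fun x => (f x).elim 0 fun y => Finsupp.single y 1

theorem partialMap_single {X : Type*} (f : X → Option X) (x : X) :
    partialMap k f (Finsupp.single x 1) = (f x).elim 0 fun y => Finsupp.single y 1 := by
  simp [partialMap]

/-- The action of the generators on the basis of the projective left module at `u`. -/
def pathAction (u : Fin m) : PreprojGen m → PathIndex u → Option (PathIndex u)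
  | .e v, x => if v.val + x.1.1 = u.val + x.1.2 then some x else none
  | .α s _ _, x =>
    if h : s.val + x.1.1 = u.val + x.1.2 ∧ x.1.2 + 1 + u.val < m then
      some ⟨(x.1.1, x.1.2 + 1), x.2.1, h.2⟩ else none
  | .αStar _ t _, x =>
    if h : t.val + x.1.1 = u.val + x.1.2 ∧ x.1.1 + 1 ≤ u.val then
      some ⟨(x.1.1 + 1, x.1.2), h.2, x.2.2⟩ else none

theorem partialMap_mul {X : Type*} (f g : X → Option X) :
    partialMap k f * partialMap k g = partialMap k fun x => (g x).bind f := by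
  ext x : 2
  simp only [LinearMap.comp_apply, Finsupp.lsingle_apply, Module.End.mul_apply, partialMap_single]
  cases g x <;> simp [partialMap_single]

theorem partialMap_eq_zero {X : Type*} {f : X → Option X} (h : ∀ x, f x = none) :
    partialMap k f = 0 := by
  ext x : 2
  simp [partialMap_single, h]

/-- The projective left module at `u`, as a representation on an explicit basis. -/
noncomputable def pathRep (u : Fin m) :
    PreprojAlg k m →ₐ[k] Module.End k (PathIndex u →₀ k) :=
  RingQuot.liftAlgHom k (s := PreprojRel k m)
    ⟨FreeAlgebra.lift k fun x => partialMap k (pathAction u x), by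
      intro x y h
      cases h with
      | idem v =>
        simp only [map_mul, FreeAlgebra.lift_ι_apply, partialMap_mul]
        congr 1
        funext x
        by_cases h : v.val + x.1.1 = u.val + x.1.2 <;> simp [pathAction, h]
      | orth v v' h =>
        simp only [map_mul, FreeAlgebra.lift_ι_apply, partialMap_mul, map_zero]
        refine partialMap_eq_zero k fun x => ?_
        have h' : v.val ≠ v'.val := fun h' => h (Fin.ext h')
        by_cases h : v'.val + x.1.1 = u.val + x.1.2
        · simp [pathAction, h, show ¬ v.val + x.1.1 = u.val + x.1.2 by omega]
        · simp [pathAction, h]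
      | one =>
        simp only [map_sum, FreeAlgebra.lift_ι_apply, map_one]
        ext x : 2
        have hx := x.2
        simp only [LinearMap.comp_apply, Finsupp.lsingle_apply, LinearMap.sum_apply,
          partialMap_single, Module.End.one_apply]
        -- Only the idempotent at the endpoint of the path acts nontrivially; the subtraction is not
        -- truncated, since `x.1.1 ≤ u`.
        rw [Finset.sum_eq_single ⟨u.val + x.1.2 - x.1.1, by omega⟩]
        · simp [pathAction, show u.val + x.1.2 - x.1.1 + x.1.1 = u.val + x.1.2 by omega]
        · intro v _ hv
          rw [pathAction, if_neg, Option.elim_none]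
          intro h
          exact hv (Fin.ext (by simp only; omega))
        · simp
      | arrow s t h =>
        simp only [map_mul, FreeAlgebra.lift_ι_apply, partialMap_mul]
        congr 1
        funext x
        by_cases h1 : s.val + x.1.1 = u.val + x.1.2
        · by_cases h2 : x.1.2 + 1 + u.val < m
          · simp [pathAction, h1, h2]
            omega
          · simp [pathAction, h1, h2]
        · simp [pathAction, h1]
      | arrowStar s t h =>
        simp only [map_mul, FreeAlgebra.lift_ι_apply, partialMap_mul]
        congr 1
        funext x
        by_cases h1 : t.val + x.1.1 = u.val + x.1.2
        · by_cases h2 : x.1.1 < u.val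
          · simp [pathAction, h1, h2]
            omega
          · simp [pathAction, h1, h2]
        · simp [pathAction, h1]
      | inner r s t h h' =>
        simp only [map_mul, FreeAlgebra.lift_ι_apply, partialMap_mul]
        congr 1
        funext x
        have e2 : (t.val + x.1.1 = u.val + (x.1.2 + 1)) ↔ (s.val + x.1.1 = u.val + x.1.2) := by
          omega
        have e3 : (r.val + (x.1.1 + 1) = u.val + x.1.2) ↔ (s.val + x.1.1 = u.val + x.1.2) := by
          omega
        by_cases h1 : s.val + x.1.1 = u.val + x.1.2 <;>
        by_cases h2 : x.1.1 + 1 ≤ u.val <;>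
        by_cases h3 : x.1.2 + 1 + u.val < m <;>
        simp [pathAction, h1, h2, h3, e2, e3]
      | first s t h hs =>
        simp only [map_mul, FreeAlgebra.lift_ι_apply, partialMap_mul, map_zero]
        refine partialMap_eq_zero k fun x => ?_
        have hx := x.2
        by_cases h1 : s.val + x.1.1 = u.val + x.1.2 <;>
        by_cases h3 : x.1.2 + 1 + u.val < m <;>
        simp [pathAction, h1, h3]
        omega
      | last s t h ht =>
        simp only [map_mul, FreeAlgebra.lift_ι_apply, partialMap_mul, map_zero]
        refine partialMap_eq_zero k fun x => ?_
        have hx := x.2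
        by_cases h1 : t.val + x.1.1 = u.val + x.1.2 <;>
        by_cases h3 : x.1.1 + 1 ≤ u.val <;>
        simp [pathAction, h1, h3]
        omega⟩

theorem pathRep_gen (u : Fin m) (x : PreprojGen m) :
    pathRep k u (gen k x) = partialMap k (pathAction u x) := by
  rw [pathRep, gen, RingQuot.liftAlgHom_mkAlgHom_apply, FreeAlgebra.lift_ι_apply]

/-- The basis vector of the projective left module at `u` that corresponds to a path, and `0` if
the path is `0`. -/
noncomputable def pathVec (u : Fin m) (a b : ℕ) : PathIndex u →₀ k :=
  if h : a ≤ u.val ∧ b + u.val < m then Finsupp.single ⟨(a, b), h⟩ 1 else 0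

theorem pathRep_idem_pathVec (u v : Fin m) (a b : ℕ) : pathRep k u (idem k v) (pathVec k u a b) =
    if v.val + a = u.val + b then pathVec k u a b else 0 := by
  rw [idem_eq_gen, pathRep_gen, pathVec]
  by_cases h : a ≤ u.val ∧ b + u.val < m
  · rw [dif_pos h, partialMap_single, pathAction]
    split_ifs <;> simp
  · simp [h]

theorem pathRep_right_pathVec (u : Fin m) (a b : ℕ) :
    pathRep k u (right k m) (pathVec k u a b) = pathVec k u a (b + 1) := by
  by_cases h : a ≤ u.val ∧ b + u.val < m
  · obtain ⟨v, hv⟩ : ∃ v : Fin m, v.val + a = u.val + b :=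
      ⟨⟨u.val + b - a, by omega⟩, by simp only; omega⟩
    have h1 := pathRep_idem_pathVec k u v a b
    rw [if_pos hv] at h1
    rw [← h1, ← Module.End.mul_apply, ← map_mul]
    by_cases h2 : v.val + 1 = m
    · rw [right_mul_idem_last k h2, map_zero, LinearMap.zero_apply, pathVec, dif_neg (by omega)]
    · have h3 : v.val + 1 = (⟨v.val + 1, by omega⟩ : Fin m).val := rfl
      rw [right_mul_idem k h3, pathRep_gen, pathVec, dif_pos h, partialMap_single, pathAction,
        pathVec]
      by_cases h4 : b + 1 + u.val < m
      · simp [hv, h4, h.1]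
      · simp [h4]
  · rw [pathVec, dif_neg h, map_zero, pathVec, dif_neg (by omega)]

theorem pathRep_left_pathVec (u : Fin m) (a b : ℕ) :
    pathRep k u (left k m) (pathVec k u a b) = pathVec k u (a + 1) b := by
  by_cases h : a ≤ u.val ∧ b + u.val < m
  · obtain ⟨v, hv⟩ : ∃ v : Fin m, v.val + a = u.val + b :=
      ⟨⟨u.val + b - a, by omega⟩, by simp only; omega⟩
    have h1 := pathRep_idem_pathVec k u v a b
    rw [if_pos hv] at h1
    rw [← h1, ← Module.End.mul_apply, ← map_mul]
    rcases Nat.eq_zero_or_pos v.val with h2 | h2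
    · rw [left_mul_idem_first k h2, map_zero, LinearMap.zero_apply, pathVec, dif_neg (by omega)]
    · have h3 : (⟨v.val - 1, by omega⟩ : Fin m).val + 1 = v.val := Nat.sub_add_cancel h2
      rw [left_mul_idem k h3, pathRep_gen, pathVec, dif_pos h, partialMap_single, pathAction,
        pathVec]
      by_cases h4 : a + 1 ≤ u.val
      · simp [hv, h4, h.2]
      · simp [h4]
  · rw [pathVec, dif_neg h, map_zero, pathVec, dif_neg (by omega)]

theorem pathRep_path (u u' : Fin m) (a b : ℕ) :
    pathRep k u (path k u' a b) (pathVec k u 0 0) = if u' = u then pathVec k u a b else 0 := by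
  induction b with
  | zero =>
    induction a with
    | zero =>
      rw [path_zero_zero, pathRep_idem_pathVec]
      simp [Fin.ext_iff]
    | succ a ih =>
      rw [← left_mul_path, map_mul, Module.End.mul_apply, ih]
      split_ifs
      · exact pathRep_left_pathVec ..
      · exact map_zero _
  | succ b ih =>
    rw [← right_mul_path, map_mul, Module.End.mul_apply, ih]
    split_ifs
    · exact pathRep_right_pathVec ..
    · exact map_zero _

/-- The coefficient of a nonzero path in an element of the preprojective algebra. -/
noncomputable def coeff (u : Fin m) (p : PathIndex u) : PreprojAlg k m →ₗ[k] k :=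
  Finsupp.lapply p ∘ₗ LinearMap.applyₗ (pathVec k u 0 0) ∘ₗ (pathRep k u).toLinearMap

theorem coeff_path (u : Fin m) (p : PathIndex u) (u' : Fin m) (a b : ℕ) :
    coeff k u p (path k u' a b) = if u' = u ∧ a = p.1.1 ∧ b = p.1.2 then 1 else 0 := by
  change pathRep k u (path k u' a b) (pathVec k u 0 0) p = _
  rw [pathRep_path]
  by_cases h : u' = u
  · subst h
    rw [if_pos rfl, pathVec]
    split_ifs with h1 h2 h2
    · rw [Finsupp.single_apply, if_pos (Subtype.ext (Prod.ext h2.2.1 h2.2.2))]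
    · rw [Finsupp.single_apply, if_neg]
      rintro rfl
      exact h2 ⟨rfl, rfl, rfl⟩
    · exact absurd ⟨h2.2.1 ▸ p.2.1, h2.2.2 ▸ p.2.2⟩ h1
    · rfl
  · simp [h]

variable {k} in
-- This is how linear independence is used: a nonzero path lies in a span of paths only if it
-- satisfies the defining condition itself.
theorem coeff_eq_zero {P : Fin m → ℕ → ℕ → Prop} {u : Fin m} {p : PathIndex u}
    (h : ¬ P u p.1.1 p.1.2) {x : PreprojAlg k m} (hx : x ∈ pathSpan k P) : coeff k u p x = 0 := by
  have : pathSpan k P ≤ LinearMap.ker (coeff k u p) := by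
    refine pathSpan_le fun u' a b hP => ?_
    rw [LinearMap.mem_ker, coeff_path, if_neg]
    rintro ⟨rfl, rfl, rfl⟩
    exact h hP
  exact this hx

end Coefficient

end PreprojAlg

/-! ### Corner counts and the exchange property of reduced words. -/

section Permutations

variable {m : ℕ}

/-- The number of `i < x` such that `w⁻¹ i < y`. -/
def cornerCount (w : Equiv.Perm (Fin (m + 1))) (x y : ℕ) : ℕ :=
  (Finset.univ.filter fun i : Fin (m + 1) => i.val < x ∧ (w⁻¹ i).val < y).card

theorem cornerCount_zero (w : Equiv.Perm (Fin (m + 1))) (y : ℕ) : cornerCount w 0 y = 0 := by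
  simp [cornerCount]

theorem cornerCount_succ (w : Equiv.Perm (Fin (m + 1))) (i : Fin (m + 1)) (y : ℕ) :
    cornerCount w (i + 1) y = cornerCount w i y + if (w⁻¹ i).val < y then 1 else 0 := by
  have h : (Finset.univ.filter fun j : Fin (m + 1) => j.val < i + 1 ∧ (w⁻¹ j).val < y) =
      (Finset.univ.filter fun j : Fin (m + 1) => j.val < i ∧ (w⁻¹ j).val < y) ∪
        (if (w⁻¹ i).val < y then {i} else ∅) := by
    ext j
    simp only [Finset.mem_filter_univ, Finset.mem_union]
    split_ifs with h
    · simp only [Finset.mem_singleton]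
      constructor
      · rintro ⟨h1, h2⟩
        rcases Nat.lt_succ_iff_lt_or_eq.1 h1 with h3 | h3
        · exact Or.inl ⟨h3, h2⟩
        · exact Or.inr (Fin.ext h3)
      · rintro (⟨h1, h2⟩ | rfl)
        · exact ⟨by omega, h2⟩
        · exact ⟨by omega, h⟩
    · simp only [Finset.notMem_empty, or_false]
      refine and_congr_left fun h2 => ⟨fun h1 => ?_, fun h1 => by omega⟩
      rcases Nat.lt_succ_iff_lt_or_eq.1 h1 with h3 | h3
      · exact h3
      · rw [Fin.ext h3] at h2
        exact absurd h2 h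
  rw [cornerCount, h, Finset.card_union_of_disjoint, cornerCount]
  · split_ifs <;> simp
  · rw [Finset.disjoint_left]
    intro j hj hj'
    split_ifs at hj'
    · rw [Finset.mem_singleton] at hj'
      subst hj'
      exact absurd (Finset.mem_filter_univ _ |>.1 hj).1 (lt_irrefl _)
    · exact absurd hj' (Finset.notMem_empty _)

theorem cornerCount_le_right (w : Equiv.Perm (Fin (m + 1))) (x y : ℕ) : cornerCount w x y ≤ y := by
  rw [cornerCount]
  refine (Finset.card_le_card_of_injOn (t := Finset.range y) (fun i => (w⁻¹ i).val) ?_ ?_).trans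
    (Finset.card_range y).le
  · intro i hi
    simp only [Finset.coe_filter, Finset.mem_univ, true_and, Set.mem_ofPred_eq] at hi
    simpa using hi.2
  · intro i _ j _ h
    exact w⁻¹.injective (Fin.ext h)

theorem cornerCount_le_left (w : Equiv.Perm (Fin (m + 1))) (x y : ℕ) : cornerCount w x y ≤ x := by
  rw [cornerCount]
  refine (Finset.card_le_card_of_injOn (t := Finset.range x) (fun i => i.val) ?_ ?_).trans
    (Finset.card_range x).le
  · intro i hi
    simp only [Finset.coe_filter, Finset.mem_univ, true_and, Set.mem_ofPred_eq] at hi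
    simpa using hi.1
  · intro i _ j _ h
    exact Fin.ext h

theorem cornerCount_top (w : Equiv.Perm (Fin (m + 1))) {y : ℕ} (hy : y ≤ m + 1) :
    cornerCount w (m + 1) y = y := by
  refine (cornerCount_le_right w _ y).antisymm ?_
  rw [cornerCount]
  refine (Finset.card_range y).ge.trans (Finset.card_le_card_of_surjOn (fun i => (w⁻¹ i).val) ?_)
  intro j hj
  have hj' : j < y := by simpa using hj
  exact ⟨w ⟨j, by omega⟩, by simp [hj']; omega, by simp⟩

theorem cornerCount_one {x : ℕ} (hx : x ≤ m + 1) (y : ℕ) :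
    cornerCount (1 : Equiv.Perm (Fin (m + 1))) x y = min x y := by
  refine (le_min (cornerCount_le_left _ _ _) (cornerCount_le_right _ _ _)).antisymm ?_
  rw [cornerCount]
  refine (Finset.card_range _).ge.trans (Finset.card_le_card_of_surjOn (fun i => i.val) ?_)
  intro j hj
  have hj' : j < min x y := by simpa using hj
  exact ⟨⟨j, by omega⟩, by simp; omega, rfl⟩

theorem cornerCount_mono (w : Equiv.Perm (Fin (m + 1))) {x x' : ℕ} (y : ℕ) (h : x ≤ x') :
    cornerCount w x y ≤ cornerCount w x' y :=
  Finset.card_le_card (Finset.monotone_filter_right _ fun _ _ hi => ⟨hi.1.trans_le h, hi.2⟩)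

/-- The count grows by at most one with each unit of `x`. -/
theorem cornerCount_le_add (w : Equiv.Perm (Fin (m + 1))) {x x' a : ℕ} (y : ℕ) (hx : x ≤ m + 1)
    (h : x ≤ x' + a) : cornerCount w x y ≤ cornerCount w x' y + a := by
  induction a generalizing x with
  | zero => exact cornerCount_mono w y h
  | succ a ih =>
    cases x with
    | zero => simp [cornerCount_zero]
    | succ x =>
      have h1 := ih (x := x) (by omega) (by omega)
      have h2 := cornerCount_succ w ⟨x, by omega⟩ y
      simp only at h2
      split_ifs at h2 <;> omega

theorem adjacentSwap_mul_self (v : Fin m) : adjacentSwap v * adjacentSwap v = 1 :=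
  Equiv.swap_mul_self _ _

theorem adjacentSwap_inv (v : Fin m) : (adjacentSwap v)⁻¹ = adjacentSwap v := Equiv.swap_inv _ _

theorem adjacentSwap_val_lt_iff (v : Fin m) (i : Fin (m + 1)) {x : ℕ} (hx : x ≠ v.val + 1) :
    (adjacentSwap v i).val < x ↔ i.val < x := by
  rw [adjacentSwap, Equiv.swap_apply_def]
  split_ifs with h1 h2
  · rw [h1]; simp; omega
  · rw [h2]; simp; omega
  · rfl

/-- The transposition maps the set of all `i < x` to itself unless `x` separates the two points that
it exchanges. -/
theorem cornerCount_adjacentSwap_mul_of_ne (w : Equiv.Perm (Fin (m + 1))) (v : Fin m) {x : ℕ}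
    (hx : x ≠ v.val + 1) (y : ℕ) : cornerCount (adjacentSwap v * w) x y = cornerCount w x y := by
  rw [cornerCount, cornerCount]
  refine Finset.card_bij (fun i _ => adjacentSwap v i) ?_ ?_ ?_
  · intro i hi
    rw [Finset.mem_filter_univ] at hi ⊢
    rw [adjacentSwap_val_lt_iff v i hx]
    refine ⟨hi.1, ?_⟩
    rw [mul_inv_rev, adjacentSwap_inv] at hi
    exact hi.2
  · exact fun _ _ _ _ h => (adjacentSwap v).injective h
  · intro i hi
    have h1 : adjacentSwap v (adjacentSwap v i) = i := by
      rw [← Equiv.Perm.mul_apply, adjacentSwap_mul_self, Equiv.Perm.one_apply]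
    refine ⟨adjacentSwap v i, ?_, h1⟩
    rw [Finset.mem_filter_univ] at hi ⊢
    rw [adjacentSwap_val_lt_iff v i hx, mul_inv_rev, adjacentSwap_inv, Equiv.Perm.mul_apply, h1]
    exact hi

theorem cornerCount_adjacentSwap_mul_self (w : Equiv.Perm (Fin (m + 1))) (v : Fin m) (y : ℕ) :
    cornerCount (adjacentSwap v * w) (v + 1) y =
      cornerCount w v y + if (w⁻¹ v.succ).val < y then 1 else 0 := by
  have h := cornerCount_succ (adjacentSwap v * w) v.castSucc y
  rw [Fin.val_castSucc, cornerCount_adjacentSwap_mul_of_ne w v (x := v) (by omega)] at h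
  rw [h, mul_inv_rev, adjacentSwap_inv, Equiv.Perm.mul_apply, adjacentSwap, Equiv.swap_apply_left]

/-- The strong exchange property. The inversion `(x, y)` is carried through the word by conjugation
until it becomes the pair exchanged by some letter; deleting that letter multiplies the product by
`swap x y`. -/
theorem exists_word_swap_mul (l : List (Fin m)) (x y : Fin (m + 1)) (hxy : x < y)
    (h : (l.map adjacentSwap).prod⁻¹ y < (l.map adjacentSwap).prod⁻¹ x) :
    ∃ l' : List (Fin m), l'.length < l.length ∧
      (l'.map adjacentSwap).prod = Equiv.swap x y * (l.map adjacentSwap).prod := by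
  induction l generalizing x y with
  | nil => simp at h; exact absurd h hxy.not_gt
  | cons v t ih =>
    rw [List.map_cons, List.prod_cons, mul_inv_rev, adjacentSwap_inv, Equiv.Perm.mul_apply,
      Equiv.Perm.mul_apply] at h
    by_cases hv : x = v.castSucc ∧ y = v.succ
    · refine ⟨t, by simp, ?_⟩
      rw [List.map_cons, List.prod_cons, hv.1, hv.2, ← mul_assoc]
      change _ = adjacentSwap v * adjacentSwap v * _
      rw [adjacentSwap_mul_self, one_mul]
    · have hlt : adjacentSwap v x < adjacentSwap v y := by
        simp only [adjacentSwap, Equiv.swap_apply_def, Fin.ext_iff, Fin.lt_def] at hv hxy ⊢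
        split_ifs <;> simp_all <;> omega
      obtain ⟨t', ht', h'⟩ := ih _ _ hlt h
      refine ⟨v :: t', by simpa using ht', ?_⟩
      rw [List.map_cons, List.prod_cons, h', Equiv.swap_apply_apply, adjacentSwap_inv,
        List.map_cons, List.prod_cons]
      simp only [← mul_assoc]
      rw [adjacentSwap_mul_self, one_mul]

theorem IsReducedExpression.tail {v : Fin m} {l : List (Fin m)} {w : Equiv.Perm (Fin (m + 1))}
    (h : IsReducedExpression (v :: l) w) : IsReducedExpression l (l.map adjacentSwap).prod := by
  refine ⟨rfl, fun l' hl' => ?_⟩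
  have := h.2 (v :: l') (by rw [List.map_cons, List.prod_cons, hl', ← h.1]; simp)
  simpa using this

/-- Otherwise the exchange property would give a word for `w` that is shorter than `l`. -/
theorem IsReducedExpression.inv_lt_inv {v : Fin m} {l : List (Fin m)}
    {w : Equiv.Perm (Fin (m + 1))} (h : IsReducedExpression (v :: l) w) :
    (l.map adjacentSwap).prod⁻¹ v.castSucc < (l.map adjacentSwap).prod⁻¹ v.succ := by
  by_contra hlt
  have hne : (l.map adjacentSwap).prod⁻¹ v.succ ≠ (l.map adjacentSwap).prod⁻¹ v.castSucc :=
    fun h' => (Fin.castSucc_lt_succ (i := v)).ne' ((l.map adjacentSwap).prod⁻¹.injective h')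
  obtain ⟨l', hl', h'⟩ := exists_word_swap_mul l _ _ (Fin.castSucc_lt_succ (i := v))
    (lt_of_le_of_ne (not_lt.1 hlt) hne)
  have := h.2 l' (by rw [h', ← h.1]; simp [adjacentSwap])
  simp at this
  omega

end Permutations

/-! ### The radical filtration and the permutation ideals in terms of paths. -/

namespace PreprojAlg

variable (k : Type*) [Field k] {m : ℕ}

theorem pathSpan_le_of_ne_zero {P : Fin m → ℕ → ℕ → Prop} {S : Submodule k (PreprojAlg k m)}
    (h : ∀ u a b, P u a b → a ≤ u.val → b + u.val < m → path k u a b ∈ S) :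
    pathSpan k P ≤ S := by
  refine pathSpan_le fun u a b hP => ?_
  by_cases h1 : a ≤ u.val
  · by_cases h2 : b + u.val < m
    · exact h u a b hP h1 h2
    · rw [path_eq_zero_of_le_right k (by omega)]
      exact zero_mem _
  · rw [path_eq_zero_of_lt_left k (by omega)]
    exact zero_mem _

theorem simpleChar_gen (v : Fin m) (x : PreprojGen m) :
    simpleChar k v (gen k x) = simpleAction k v x := by
  rw [simpleChar, gen, RingQuot.liftAlgHom_mkAlgHom_apply, FreeAlgebra.lift_ι_apply]

theorem simpleChar_path (v u : Fin m) (a b : ℕ) :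
    simpleChar k v (path k u a b) = if u = v ∧ a = 0 ∧ b = 0 then 1 else 0 := by
  have hr : simpleChar k v (right k m) = 0 := by
    rw [right, map_sum]
    refine Finset.sum_eq_zero fun s _ => ?_
    rw [map_sum]
    refine Finset.sum_eq_zero fun t _ => ?_
    split_ifs
    · exact simpleChar_gen k v _
    · exact map_zero _
  have hl : simpleChar k v (left k m) = 0 := by
    rw [left, map_sum]
    refine Finset.sum_eq_zero fun s _ => ?_
    rw [map_sum]
    refine Finset.sum_eq_zero fun t _ => ?_
    split_ifs
    · exact simpleChar_gen k v _
    · exact map_zero _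
  rw [path, map_mul, map_mul, map_pow, map_pow, hr, hl, idem_eq_gen, simpleChar_gen, simpleAction]
  cases a <;> cases b <;> simp

/-- Modulo the paths of positive length only the idempotents remain, and the characters read off
their coefficients. -/
theorem sub_sum_simpleChar_mem (x : PreprojAlg k m) :
    x - ∑ v, simpleChar k v x • idem k v ∈ pathSpan k fun _ a b => 0 < a + b := by
  have hx : x ∈ pathSpan k (fun (_ : Fin m) _ _ => True) := by rw [pathSpan_true]; trivial
  rw [pathSpan] at hx
  induction hx using Submodule.span_induction with
  | mem x hx =>
    obtain ⟨u, a, b, -, rfl⟩ := hx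
    simp only [simpleChar_path]
    by_cases h : a = 0 ∧ b = 0
    · simp [h.1, h.2, path_zero_zero]
    · simp only [h, and_false, if_false, zero_smul, Finset.sum_const_zero, sub_zero]
      exact path_mem_pathSpan (by omega)
  | zero => simp
  | add x y _ _ hx hy =>
    simp only [map_add, add_smul, Finset.sum_add_distrib]
    rw [add_sub_add_comm]
    exact add_mem hx hy
  | smul c x _ hx =>
    simp only [map_smul, smul_eq_mul, mul_smul]
    rw [← Finset.smul_sum, ← smul_sub]
    exact Submodule.smul_mem _ _ hx

theorem vertexIdeal_eq (v : Fin m) :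
    vertexIdeal k v = pathSpan k fun u a b => ¬ (u = v ∧ a = 0 ∧ b = 0) := by
  apply le_antisymm
  · intro x hx
    have hx0 : simpleChar k v x = 0 := hx
    rw [← sub_add_cancel x (∑ u, simpleChar k u x • idem k u)]
    refine add_mem (pathSpan_le (fun u a b h => path_mem_pathSpan (by omega))
      (sub_sum_simpleChar_mem k x)) (sum_mem fun u _ => ?_)
    by_cases hu : u = v
    · rw [hu, hx0, zero_smul]; exact zero_mem _
    · rw [← path_zero_zero]
      exact Submodule.smul_mem _ _ (path_mem_pathSpan (by tauto))
  · refine pathSpan_le fun u a b h => ?_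
    change simpleChar k v _ = 0
    rw [simpleChar_path, if_neg h]

theorem pathSpan_pow_le (d : ℕ) : pathSpan k (fun (_ : Fin m) a b => 0 < a + b) ^ d ≤
    pathSpan k fun (_ : Fin m) a b => d ≤ a + b := by
  induction d with
  | zero => simp only [Nat.zero_le, pathSpan_true]; exact le_top
  | succ d ih =>
    rw [pow_succ]
    refine (mul_le_mul' ih le_rfl).trans (pathSpan_mul_le k ?_)
    exact fun _ _ _ _ _ _ h h' _ => path_mem_pathSpan (by omega)

/-- The radical is killed by every character of a simple module. Conversely, the paths of positive
length span a nilpotent ideal. -/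
theorem radical_eq : radical k m = pathSpan k fun (_ : Fin m) a b => 0 < a + b := by
  ext x
  rw [radical, Submodule.restrictScalars_mem, ← Ideal.jacobson_bot, Ideal.mem_jacobson_iff]
  simp only [Ideal.mem_bot]
  constructor
  · intro h
    have h0 : ∀ v, simpleChar k v x = 0 := by
      intro v
      by_contra hv
      -- With this scalar `y` the element `y * x` has character `-1`, so `z * y * x + z - 1 = 0`
      -- becomes `-1 = 0`.
      obtain ⟨z, hz⟩ := h (algebraMap k _ (-(simpleChar k v x)⁻¹))
      have := congrArg (simpleChar k v) hz
      simp [mul_assoc, hv] at this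
    have := sub_sum_simpleChar_mem k x
    simpa [h0] using this
  · intro hx y
    have hyx : y * x ∈ pathSpan k (fun (_ : Fin m) a b => 0 < a + b) := by
      have hy : y ∈ pathSpan k (fun (_ : Fin m) _ _ => True) := by rw [pathSpan_true]; trivial
      refine pathSpan_mul_le k ?_ (Submodule.mul_mem_mul hy hx)
      exact fun _ _ _ _ _ _ h h' _ => path_mem_pathSpan (by omega)
    have hnil : IsNilpotent (y * x) := by
      -- A nonzero path has `a ≤ u` and `b + u < m`, hence length less than `m`.
      refine ⟨m, ?_⟩
      have h1 := pathSpan_pow_le k m (Submodule.pow_mem_pow _ hyx m)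
      have h2 : pathSpan k (fun (_ : Fin m) a b => m ≤ a + b) ≤ ⊥ :=
        pathSpan_le_of_ne_zero k fun u a b h h1 h2 => by omega
      exact (Submodule.mem_bot k).1 (h2 h1)
    obtain ⟨z, hz⟩ := hnil.isUnit_one_add.exists_left_inv
    refine ⟨z, ?_⟩
    rw [← hz]
    noncomm_ring

theorem projective_eq (v : Fin m) :
    projective k v = pathSpan k fun u a b => v.val + a = u.val + b := by
  apply le_antisymm
  · rw [projective, LinearMap.range_eq_map, ← pathSpan_true, Submodule.map_le_iff_le_comap]
    refine pathSpan_le fun u a b _ => ?_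
    rw [Submodule.mem_comap, LinearMap.mulLeft_apply, idem_mul_path]
    split_ifs with h
    · exact path_mem_pathSpan h
    · exact zero_mem _
  · exact pathSpan_le fun u a b h => ⟨path k u a b, by
      rw [LinearMap.mulLeft_apply, idem_mul_path, if_pos h]⟩

theorem radicalFiltration_eq (v : Fin m) (d : ℕ) : radicalFiltration k v d =
    pathSpan k fun u a b => v.val + a = u.val + b ∧ d ≤ a + b := by
  induction d with
  | zero => simp [radicalFiltration, projective_eq]
  | succ d ih =>
    rw [radicalFiltration, pow_succ, ← mul_assoc]
    rw [radicalFiltration] at ih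
    rw [ih, radical_eq]
    apply le_antisymm
    · refine pathSpan_mul_le k fun u a b u' a' b' h h' h0 => path_mem_pathSpan ?_
      constructor <;> omega
    · refine pathSpan_le_of_ne_zero k fun u a b h h1 h2 => ?_
      -- A path of length at least `d + 1` is split after its first step, which becomes the right
      -- factor in the radical. This step goes right if `a = 0`; otherwise a left step is taken
      -- first.
      rcases Nat.eq_zero_or_pos a with ha | ha
      · obtain ⟨t, ht⟩ : ∃ t : Fin m, t.val = u.val + 1 := ⟨⟨u.val + 1, by omega⟩, rfl⟩
        have := path_mul_path k t u a (b - 1) 0 1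
        rw [if_pos (by omega), add_zero, Nat.sub_add_cancel (by omega)] at this
        rw [← this]
        exact Submodule.mul_mem_mul (path_mem_pathSpan (by omega)) (path_mem_pathSpan (by omega))
      · obtain ⟨t, ht⟩ : ∃ t : Fin m, t.val + 1 = u.val :=
          ⟨⟨u.val - 1, by omega⟩, Nat.sub_add_cancel (by omega)⟩
        have := path_mul_path k t u (a - 1) b 1 0
        rw [if_pos (by omega), add_zero, Nat.sub_add_cancel (by omega)] at this
        rw [← this]
        exact Submodule.mul_mem_mul (path_mem_pathSpan (by omega)) (path_mem_pathSpan (by omega))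

/-- Multiplying by `I_{v₀}` on the left changes only the summand at `v₀`: there a path must end with
a genuine step from a neighbour. The corner counts of `s_{v₀} w'` and `w'` differ only at `v₀ + 1`,
and the new count is exactly the threshold for such a last step to exist. -/
theorem permutationIdeal_eq {word : List (Fin m)} {w : Equiv.Perm (Fin (m + 1))}
    (h : IsReducedExpression word w) : permutationIdeal k word = pathSpan k fun u a b =>
      ∃ v : Fin m, v.val + a = u.val + b ∧ u.val + 1 ≤ a + cornerCount w (v + 1) (u + 1) := by
  induction word generalizing w with
  | nil =>
    obtain rfl : 1 = w := by simpa using h.1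
    refine (top_le_iff.1 ?_).symm
    rw [← pathSpan_true]
    refine pathSpan_le_of_ne_zero k fun u a b _ h1 h2 => path_mem_pathSpan ?_
    refine ⟨⟨u.val + b - a, by omega⟩, by simp only; omega, ?_⟩
    rw [cornerCount_one (by simp only; omega)]
    simp only
    omega
  | cons v₀ l ih =>
    rw [permutationIdeal, ih h.tail, vertexIdeal_eq]
    have hlt := h.inv_lt_inv
    obtain rfl : adjacentSwap v₀ * (l.map adjacentSwap).prod = w := by simpa using h.1
    set w' := (l.map adjacentSwap).prod
    have hne : ∀ x y : ℕ, x ≠ v₀ + 1 →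
        cornerCount (adjacentSwap v₀ * w') x y = cornerCount w' x y :=
      fun x y hx => cornerCount_adjacentSwap_mul_of_ne w' v₀ hx y
    have hself := cornerCount_adjacentSwap_mul_self w' v₀
    have hs1 : ∀ y : ℕ, cornerCount w' (v₀ + 1) y = _ := cornerCount_succ w' v₀.castSucc
    have hs2 : ∀ y : ℕ, cornerCount w' (v₀ + 1 + 1) y = _ := cornerCount_succ w' v₀.succ
    simp only [Fin.val_castSucc, Fin.val_succ] at hs1 hs2
    rw [Fin.lt_def] at hlt
    apply le_antisymm
    · refine pathSpan_mul_le k fun t a b u a' b' hP hQ h0 => ?_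
      obtain ⟨t', ht', hc⟩ := hQ
      obtain rfl : t = t' := Fin.ext (by omega)
      by_cases h1 : path k u (a + a') (b + b') = 0
      · rw [h1]; exact zero_mem _
      obtain ⟨v, hv⟩ := exists_target k h1
      refine path_mem_pathSpan ⟨v, hv, ?_⟩
      have ht := t.2
      by_cases hvv : v = v₀
      · subst hvv
        have hself := hself (u + 1)
        have hs1 := hs1 (u + 1)
        have hs2 := hs2 (u + 1)
        rcases Nat.eq_zero_or_pos b with hb | hb
        · have ha : 0 < a := by
            by_contra ha
            exact hP ⟨Fin.ext (by omega), by omega, hb⟩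
          -- The left factor consists of `a > 0` left steps, so it reaches `v` through `v + 1`. The
          -- count is therefore compared at `v + 2`, and it loses at most one between there and the
          -- new count at `v + 1`.
          have := cornerCount_le_add w' (x := t + 1) (x' := v + 1 + 1) (a := a - 1) (u + 1)
            (by omega) (by omega)
          split_ifs at hself hs1 hs2 <;> omega
        · have := cornerCount_le_add w' (x := t + 1) (x' := v) (a := a) (u + 1)
            (by omega) (by omega)
          omega
      · rw [hne _ _ fun h => hvv (Fin.ext (by omega))]
        have := cornerCount_le_add w' (x := t + 1) (x' := v + 1) (a := a) (u + 1)
            (by omega) (by omega)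
        omega
    · refine pathSpan_le_of_ne_zero k fun u a b ⟨v, hv, hc⟩ h1 h2 => ?_
      by_cases hvv : v = v₀
      · subst hvv
        have hself := hself (u + 1)
        have hs1 := hs1 (u + 1)
        have hs2 := hs2 (u + 1)
        -- This decides the last step. If it holds, reducedness gives the same for `v.castSucc`, the
        -- count of `w'` at `v + 2` exceeds the new one by one, and a left step from `v + 1` can be
        -- split off. If it fails, the new count is that of `w'` at `v`, and a right step from `v -
        -- 1` can be split off.
        by_cases hB : (w'⁻¹ v.succ).val < u + 1
        · have hA : (w'⁻¹ v.castSucc).val < u + 1 := hlt.trans hB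
          rw [if_pos hB] at hself hs2
          rw [if_pos hA] at hs1
          have hle := cornerCount_le_right w' (v + 1 + 1) (u + 1)
          have ha : 0 < a := by omega
          have hvm : v.val + 1 < m := by
            by_contra hvm
            have := cornerCount_top w' (y := u + 1) (by omega)
            rw [show v.val + 1 + 1 = m + 1 by omega] at hs2
            omega
          obtain ⟨t, ht⟩ : ∃ t : Fin m, t.val = v.val + 1 := ⟨⟨v.val + 1, hvm⟩, rfl⟩
          have := path_mul_path k t u 1 0 (a - 1) b
          rw [if_pos (by omega), zero_add, Nat.add_sub_cancel' (by omega)] at this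
          rw [← this]
          refine Submodule.mul_mem_mul (path_mem_pathSpan (by omega))
            (path_mem_pathSpan ⟨t, by omega, ?_⟩)
          rw [ht]
          omega
        · rw [if_neg hB] at hself
          have hle := cornerCount_le_left w' v (u + 1)
          have hv0 : 0 < v.val := by
            by_contra hv0
            omega
          obtain ⟨t, ht⟩ : ∃ t : Fin m, t.val + 1 = v.val :=
            ⟨⟨v.val - 1, by omega⟩, Nat.sub_add_cancel hv0⟩
          have := path_mul_path k t u 0 1 a (b - 1)
          rw [if_pos (by omega), zero_add, Nat.add_sub_cancel' (by omega)] at this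
          rw [← this]
          refine Submodule.mul_mem_mul (path_mem_pathSpan (by omega))
            (path_mem_pathSpan ⟨t, by omega, ?_⟩)
          rw [ht]
          omega
      · have := path_mul_path k v u 0 0 a b
        rw [if_pos hv, zero_add, zero_add] at this
        rw [← this]
        refine Submodule.mul_mem_mul (path_mem_pathSpan (by tauto)) (path_mem_pathSpan ⟨v, hv, ?_⟩)
        rwa [hne _ _ fun h => hvv (Fin.ext (by omega))] at hc

/-- Length and endpoints determine a path, so the `u`-component of a radical layer has dimension at
most one, and it meets `I_w` exactly if its path lies in `I_w`. -/
theorem hasFactor_permutationIdeal_iff {word : List (Fin m)} {w : Equiv.Perm (Fin (m + 1))}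
    (h : IsReducedExpression word w) (v u : Fin m) (d : ℕ) :
    HasFactor k (summand k (permutationIdeal k word) v) v u d ↔
      ∃ a b : ℕ, a + b = d ∧ v.val + a = u.val + b ∧ a ≤ u.val ∧ b + u.val < m ∧
        u.val + 1 ≤ a + cornerCount w (v + 1) (u + 1) := by
  rw [HasFactor, summand, permutationIdeal_eq k h, projective_eq, radicalFiltration_eq,
    radicalFiltration_eq]
  constructor
  · rintro ⟨x, ⟨⟨hx, -⟩, hxd⟩, hxu⟩
    have hp : ∃ p : PathIndex u, p.1.1 + p.1.2 = d ∧ v.val + p.1.1 = u.val + p.1.2 := by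
      by_contra! hp
      refine hxu ?_
      have hle : pathSpan k (fun u a b => v.val + a = u.val + b ∧ d ≤ a + b) ≤
          (pathSpan k (fun u a b => v.val + a = u.val + b ∧ d + 1 ≤ a + b)).comap
            (LinearMap.mulRight k (idem k u)) := by
        refine pathSpan_le_of_ne_zero k fun u' a b h h1 h2 => ?_
        rw [Submodule.mem_comap, LinearMap.mulRight_apply]
        by_cases hu : u' = u
        · subst hu
          rw [path_mul_idem]
          by_cases hd : a + b = d
          · exact absurd h.1 (hp ⟨(a, b), h1, h2⟩ hd)
          · exact path_mem_pathSpan (by omega)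
        · rw [path_mul_idem_of_ne k hu]; exact zero_mem _
      exact hle hxd
    obtain ⟨p, hpd, hpv⟩ := hp
    refine ⟨p.1.1, p.1.2, hpd, hpv, p.2.1, p.2.2, ?_⟩
    by_contra hc
    have h0 : coeff k u p x = 0 := by
      refine coeff_eq_zero ?_ hx
      rintro ⟨v', hv', hc'⟩
      obtain rfl : v' = v := Fin.ext (by omega)
      exact hc hc'
    refine hxu ?_
    -- Removing from `x * idem k u` its only term of length `d` leaves an element of the next
    -- filtration step; the coefficient `h0` of this term is zero.
    have hle : pathSpan k (fun u a b => v.val + a = u.val + b ∧ d ≤ a + b) ≤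
        (pathSpan k (fun u a b => v.val + a = u.val + b ∧ d + 1 ≤ a + b)).comap
          (LinearMap.mulRight k (idem k u) -
            (coeff k u p).smulRight (path k u p.1.1 p.1.2)) := by
      refine pathSpan_le fun u' a b h => ?_
      rw [Submodule.mem_comap, LinearMap.sub_apply, LinearMap.mulRight_apply,
        LinearMap.smulRight_apply, coeff_path]
      by_cases hu : u' = u
      · subst hu
        rw [path_mul_idem]
        by_cases hd : a + b = d
        · obtain rfl : a = p.1.1 := by omega
          obtain rfl : b = p.1.2 := by omega
          simp
        · rw [if_neg (by omega), zero_smul, sub_zero]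
          exact path_mem_pathSpan (by omega)
      · rw [path_mul_idem_of_ne k hu, if_neg (by tauto), zero_smul, sub_zero]
        exact zero_mem _
    have := hle hxd
    rwa [Submodule.mem_comap, LinearMap.sub_apply, LinearMap.mulRight_apply,
      LinearMap.smulRight_apply, h0, zero_smul, sub_zero] at this
  · rintro ⟨a, b, hd, hv, ha, hb, hc⟩
    refine ⟨path k u a b, ⟨⟨path_mem_pathSpan ⟨v, hv, hc⟩, path_mem_pathSpan hv⟩,
      path_mem_pathSpan ⟨hv, hd.ge⟩⟩, fun hmem => ?_⟩
    rw [path_mul_idem] at hmem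
    have := coeff_eq_zero (p := (⟨(a, b), ha, hb⟩ : PathIndex u)) (by simp only; omega) hmem
    simp [coeff_path] at this

end PreprojAlg

/-! ### Normal forms and lengths in the continuous category. -/

namespace RealPath

theorem len_α (x y : ℝ) (h : x < y) : len (α x y h) = y - x := by
  change (0 : ℝ) + |x - y| = y - x
  rw [zero_add, abs_sub_comm, abs_of_pos (sub_pos.2 h)]

theorem len_αStar (x y : ℝ) (h : x < y) : len (αStar x y h) = y - x := by
  change (0 : ℝ) + |y - x| = y - x
  rw [zero_add, abs_of_pos (sub_pos.2 h)]

theorem len_id (x : ℝ) : len (𝟙 (node x)) = 0 := rfl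

theorem len_α_comp_α {x y z : ℝ} (h : x < y) (h' : y < z) :
    len (α x y h ≫ α y z h') = len (α x z (h.trans h')) := by
  rw [len_comp, len_α, len_α, len_α]
  ring

theorem len_αStar_comp_αStar {x y z : ℝ} (h : x < y) (h' : y < z) :
    len (αStar y z h' ≫ αStar x y h) = len (αStar x z (h.trans h')) := by
  rw [len_comp, len_αStar, len_αStar, len_αStar]
  ring

theorem len_exchange {l x y r : ℝ} (hlx : l < x) (hly : l < y) (hxr : x < r) (hyr : y < r)
    (hsum : l + r = x + y) :
    len (α x r hxr ≫ αStar y r hyr) = len (αStar l x hlx ≫ α l y hly) := by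
  rw [len_comp, len_comp, len_α, len_α, len_αStar, len_αStar]
  linarith

theorem exists_len_eq {x y ℓ : ℝ} (h : |x - y| ≤ ℓ) : ∃ p : RealPath x y, len p = ℓ := by
  rw [abs_le] at h
  rcases h.2.eq_or_lt with h1 | h1
  · rcases (show y ≤ x ∨ x < y from le_or_gt y x) with h2 | h2
    · rcases h2.eq_or_lt with rfl | h2
      · exact ⟨𝟙 (node y), by rw [len_id]; linarith⟩
      · exact ⟨αStar y x h2, by rw [len_αStar]; linarith⟩
    · linarith
  · rcases h.1.eq_or_lt with h2 | h2
    · have h3 : x < y := by linarith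
      exact ⟨α x y h3, by rw [len_α]; linarith⟩
    -- The turning point `r` solves `(r - x) + (r - y) = ℓ`.
    · have h3 : x < (x + y + ℓ) / 2 := by linarith
      have h4 : y < (x + y + ℓ) / 2 := by linarith
      refine ⟨α x _ h3 ≫ αStar y _ h4, ?_⟩
      rw [len_comp, len_α, len_αStar]
      ring

end RealPath

namespace RealPreproj

/-- The point `x` as an object of the preprojective category before linearization. -/
abbrev pt (x : ℝ) : RealPreproj := (Quotient.functor RealRel).obj (node x)

/-- The class of a path. -/
abbrev mk {x y : ℝ} (p : RealPath x y) : pt x ⟶ pt y := (Quotient.functor RealRel).map p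

/-- The morphism that goes to the right, or does not move. -/
noncomputable def up (x y : ℝ) (h : x ≤ y) : pt x ⟶ pt y :=
  if h' : x < y then mk (RealPath.α x y h') else eqToHom (by rw [le_antisymm h (not_lt.1 h')])

/-- The morphism that goes to the left, or does not move. -/
noncomputable def down (x y : ℝ) (h : x ≤ y) : pt y ⟶ pt x :=
  if h' : x < y then mk (RealPath.αStar x y h') else eqToHom (by rw [le_antisymm h (not_lt.1 h')])

theorem up_self (x : ℝ) : up x x le_rfl = 𝟙 _ := by simp [up]

theorem down_self (x : ℝ) : down x x le_rfl = 𝟙 _ := by simp [down]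

theorem up_of_lt {x y : ℝ} (h : x < y) : up x y h.le = mk (RealPath.α x y h) := dif_pos h

theorem down_of_lt {x y : ℝ} (h : x < y) : down x y h.le = mk (RealPath.αStar x y h) := dif_pos h

theorem up_comp {x y z : ℝ} (h : x ≤ y) (h' : y ≤ z) :
    up x y h ≫ up y z h' = up x z (h.trans h') := by
  rcases h.eq_or_lt with rfl | h
  · rw [up_self, Category.id_comp]
  rcases h'.eq_or_lt with rfl | h'
  · rw [up_self, Category.comp_id]
  rw [up_of_lt h, up_of_lt h', up_of_lt (h.trans h')]
  exact ((Quotient.functor RealRel).map_comp _ _).symm.trans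
    (CategoryTheory.Quotient.sound _ (RealRel.α_comp x y z h h'))

theorem down_comp {x y z : ℝ} (h : x ≤ y) (h' : y ≤ z) :
    down y z h' ≫ down x y h = down x z (h.trans h') := by
  rcases h.eq_or_lt with rfl | h
  · rw [down_self, Category.comp_id]
  rcases h'.eq_or_lt with rfl | h'
  · rw [down_self, Category.id_comp]
  rw [down_of_lt h, down_of_lt h', down_of_lt (h.trans h')]
  exact ((Quotient.functor RealRel).map_comp _ _).symm.trans
    (CategoryTheory.Quotient.sound _ (RealRel.αStar_comp x y z h h'))

/-- The exchange relation with degenerate legs allowed: if `r` is one of `x`, `y`, then `l` is the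
other one, and both sides are a single leg. -/
theorem up_comp_down {l x y r : ℝ} (hlx : l ≤ x) (hly : l ≤ y) (hxr : x ≤ r) (hyr : y ≤ r)
    (hsum : l + r = x + y) :
    up x r hxr ≫ down y r hyr = down l x hlx ≫ up l y hly := by
  rcases hxr.eq_or_lt with rfl | hxr
  · obtain rfl : l = y := by linarith
    rw [up_self, up_self, Category.id_comp, Category.comp_id]
  rcases hyr.eq_or_lt with rfl | hyr
  · obtain rfl : l = x := by linarith
    rw [down_self, down_self, Category.id_comp, Category.comp_id]
  have hlx' : l < x := by linarith
  have hly' : l < y := by linarith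
  rw [up_of_lt hxr, down_of_lt hyr, up_of_lt hly', down_of_lt hlx']
  exact ((Quotient.functor RealRel).map_comp _ _).symm.trans
    ((CategoryTheory.Quotient.sound _ (RealRel.exchange l x y r hlx' hly' hxr hyr hsum)).trans
      ((Quotient.functor RealRel).map_comp _ _))

/-- Every path can be rewritten to go left to a point `l` and then right. The length determines `l`,
hence the morphism. -/
theorem exists_down_comp_up {x y : ℝ} (p : RealPath x y) :
    ∃ (l : ℝ) (hlx : l ≤ x) (hly : l ≤ y), 2 * l + RealPath.len p = x + y ∧
      mk p = down l x hlx ≫ up l y hly := by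
  have key : ∀ (v : RealVertex) (p : Quiver.Path (⟨x⟩ : RealVertex) v),
      ∃ (l : ℝ) (hlx : l ≤ x) (hly : l ≤ v.pos), 2 * l + pathLength p = x + v.pos ∧
        mk (x := x) (y := v.pos) p = down l x hlx ≫ up l v.pos hly := by
    intro v p
    induction p with
    | nil =>
      refine ⟨x, le_rfl, le_rfl, by simp [pathLength]; ring, ?_⟩
      rw [down_self, up_self, Category.id_comp]
      exact (Quotient.functor RealRel).map_id _
    | @cons v v' p a ih =>
      obtain ⟨l, hlx, hlv, hlen, hp⟩ := ih
      change RealArrow v v' at a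
      cases a with
      | α y z h =>
        refine ⟨l, hlx, hlv.trans h.le, ?_, ?_⟩
        · rw [pathLength, abs_sub_comm, abs_of_pos (sub_pos.2 h)]
          simp only at hlen ⊢
          linarith
        · rw [← up_comp hlv h.le, ← Category.assoc, ← hp, up_of_lt h]
          exact (Quotient.functor RealRel).map_comp
            (X := node x) (Y := node y) (Z := node z) p (RealPath.α y z h)
      | αStar z y h =>
        simp only at hlv hlen
        -- The new left step is exchanged with the final right leg, which lowers the turning point
        -- by its length `y - z`.
        refine ⟨l + z - y, by linarith, by simp only; linarith, ?_, ?_⟩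
        · rw [pathLength, abs_of_pos (sub_pos.2 h)]
          simp only
          linarith
        · rw [← down_comp (show l + z - y ≤ l by linarith) hlx, Category.assoc,
            ← up_comp_down (x := l) (r := y) (y := z) (by linarith) (by linarith) hlv h.le
              (by ring), ← Category.assoc, ← hp, down_of_lt h]
          exact (Quotient.functor RealRel).map_comp
            (X := node x) (Y := node y) (Z := node z) p (RealPath.αStar z y h)
  exact key ⟨y⟩ p

/-- The length of the morphisms of the preprojective category before linearization. -/
noncomputable def length {X Y : RealPreproj} (f : X ⟶ Y) : ℝ :=
  Quot.liftOn f (fun p => RealPath.len (x := RealVertex.pos X.as) (y := RealVertex.pos Y.as) p) (by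
    rintro _ _ ⟨a, b, f, m₁, m₂, g, h⟩
    -- The length descends to the quotient because the relations are homogeneous.
    have h' : RealPath.len (x := RealVertex.pos a) (y := RealVertex.pos b) m₁ =
        RealPath.len (x := RealVertex.pos a) (y := RealVertex.pos b) m₂ := by
      cases h with
      | α_comp x y z h h' => exact RealPath.len_α_comp_α h h'
      | αStar_comp x y z h h' => exact RealPath.len_αStar_comp_αStar h h'
      | exchange l x y r hlx hly hxr hyr hsum => exact RealPath.len_exchange hlx hly hxr hyr hsum
    refine (RealPath.len_comp (y := RealVertex.pos a) f (m₁ ≫ g)).trans ?_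
    refine Eq.trans ?_ (RealPath.len_comp (y := RealVertex.pos a) f (m₂ ≫ g)).symm
    refine congrArg _ ?_
    refine (RealPath.len_comp (y := RealVertex.pos b) m₁ g).trans ?_
    refine Eq.trans ?_ (RealPath.len_comp (y := RealVertex.pos b) m₂ g).symm
    rw [h'])

theorem length_mk {x y : ℝ} (p : RealPath x y) : length (mk p) = RealPath.len p := rfl

theorem length_comp {x y z : ℝ} (f : pt x ⟶ pt y) (g : pt y ⟶ pt z) :
    length (f ≫ g) = length f + length g := by
  obtain ⟨p, rfl⟩ := (Quotient.functor RealRel).map_surjective f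
  obtain ⟨q, rfl⟩ := (Quotient.functor RealRel).map_surjective g
  rw [← Functor.map_comp]
  exact RealPath.len_comp p q

theorem abs_sub_le_length {x y : ℝ} (f : pt x ⟶ pt y) : |x - y| ≤ length f := by
  obtain ⟨p, rfl⟩ := (Quotient.functor RealRel).map_surjective f
  exact RealPath.abs_sub_le_len p

end RealPreproj

/-! ### Which path like morphisms survive, and the picture of a decorous submodule. -/

namespace LambdaReal

variable (k : Type*) [Field k]

/-- The sum of the coefficients of the morphisms of a given length. -/
noncomputable def lengthCoeff (ℓ : ℝ) {x y : ℝ} : (pt k x ⟶ pt k y) →ₗ[k] k :=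
  Finsupp.linearCombination k
    fun f : RealPreproj.pt x ⟶ RealPreproj.pt y => by
      classical exact if RealPreproj.length f = ℓ then (1 : k) else 0

theorem lengthCoeff_of_eq {ℓ x y : ℝ} {f : RealPreproj.pt x ⟶ RealPreproj.pt y}
    (h : RealPreproj.length f = ℓ) :
    lengthCoeff k ℓ ((Free.embedding k RealPreproj).map f) = 1 := by
  refine (Finsupp.linearCombination_single k (1 : k) f).trans ?_
  simp [h]

theorem lengthCoeff_of_ne {ℓ x y : ℝ} {f : RealPreproj.pt x ⟶ RealPreproj.pt y}
    (h : RealPreproj.length f ≠ ℓ) :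
    lengthCoeff k ℓ ((Free.embedding k RealPreproj).map f) = 0 := by
  refine (Finsupp.linearCombination_single k (1 : k) f).trans ?_
  simp [h]

theorem lengthCoeff_comp {ℓ x y z : ℝ} (h : ℓ < |x - y| + |y - z|) (f : pt k x ⟶ pt k y)
    (g : pt k y ⟶ pt k z) : lengthCoeff k ℓ (f ≫ g) = 0 := by
  have hf := LambdaCat.LambdaReal_hom_mem_span k f
  have hg := LambdaCat.LambdaReal_hom_mem_span k g
  induction hf using Submodule.span_induction with
  | zero => rw [Limits.zero_comp, map_zero]
  | add a b _ _ ha hb => rw [Preadditive.add_comp, map_add, ha, hb, add_zero]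
  | smul c a _ ha => rw [Linear.smul_comp, map_smul, ha, smul_zero]
  | mem a ha =>
    obtain ⟨p, rfl⟩ := ha
    induction hg using Submodule.span_induction with
    | zero => rw [Limits.comp_zero, map_zero]
    | add a b _ _ ha hb => rw [Preadditive.comp_add, map_add, ha, hb, add_zero]
    | smul c a _ ha => rw [Linear.comp_smul, map_smul, ha, smul_zero]
    | mem b hb =>
      obtain ⟨q, rfl⟩ := hb
      rw [← Functor.map_comp]
      refine lengthCoeff_of_ne k ?_
      rw [RealPreproj.length_comp]
      have := RealPreproj.abs_sub_le_length p
      have := RealPreproj.abs_sub_le_length q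
      linarith

/-- A path through a point `z ≤ 0` has length at least `x + y`, and a path through `z ≥ 1` has
length at least `2 - x - y`. So the functional passes to `Λ_(0,1)` for these lengths. -/
theorem lengthCoeff_outsideIdeal {ℓ x y : ℝ} (h₀ : ℓ < x + y) (h₁ : ℓ < 2 - x - y)
    {f : pt k x ⟶ pt k y} (hf : f ∈ outsideIdeal k (Set.Ioo 0 1) (pt k x) (pt k y)) :
    lengthCoeff k ℓ f = 0 := by
  have hle : outsideIdeal k (Set.Ioo 0 1) (pt k x) (pt k y) ≤
      LinearMap.ker (lengthCoeff k ℓ) := by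
    rw [outsideIdeal, Submodule.span_le]
    rintro _ ⟨z, hz, g, h, rfl⟩
    refine lengthCoeff_comp k ?_ g h
    rw [Set.mem_Ioo, not_and_or, not_lt, not_lt] at hz
    rcases hz with hz | hz
    · linarith [le_abs_self (x - z), neg_abs_le (z - y)]
    · linarith [neg_abs_le (x - z), le_abs_self (z - y)]
  exact hle hf

end LambdaReal

namespace LambdaCat

variable (k : Type*) [Field k]

theorem ofPath_eq_zero_of_mk_eq_comp {𝕀 : Set ℝ} {x y z : ℝ} {p : RealPath x y}
    {f : RealPreproj.pt x ⟶ RealPreproj.pt z} {g : RealPreproj.pt z ⟶ RealPreproj.pt y}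
    (hp : RealPreproj.mk p = f ≫ g) (hz : z ∉ 𝕀) : ofPath k 𝕀 p = 0 := by
  have h : (Quotient.functor (LambdaReal.outsideRel k 𝕀)).map
      ((Free.embedding k RealPreproj).map f) = 0 :=
    hom_eq_zero_of_notMem k 𝕀 (x := x) (y := z) (Or.inr hz) _
  rw [ofPath]
  change (Quotient.functor (LambdaReal.outsideRel k 𝕀)).map
    ((Free.embedding k RealPreproj).map (RealPreproj.mk p)) = 0
  rw [hp, Functor.map_comp, Functor.map_comp, h, Limits.zero_comp]

/-- A longer path has a normal form that turns outside `(0, 1)`: at `l ≤ 0` if it first goes left,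
or at `x + y - l ≥ 1` if it first goes right. -/
theorem len_lt_of_ofPath_ne_zero {x y : ℝ} {p : RealPath x y}
    (hp : ofPath k (Set.Ioo 0 1) p ≠ 0) :
    RealPath.len p < x + y ∧ RealPath.len p < 2 - x - y := by
  have hx : x ∈ Set.Ioo (0 : ℝ) 1 := by
    by_contra hx
    exact hp (hom_eq_zero_of_notMem k _ (Or.inl hx) _)
  have hy : y ∈ Set.Ioo (0 : ℝ) 1 := by
    by_contra hy
    exact hp (hom_eq_zero_of_notMem k _ (Or.inr hy) _)
  obtain ⟨l, hlx, hly, hlen, hp'⟩ := RealPreproj.exists_down_comp_up p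
  constructor
  · by_contra h
    exact hp (ofPath_eq_zero_of_mk_eq_comp k hp' fun hl => by linarith [hl.1])
  · by_contra h
    rw [← RealPreproj.up_comp_down (r := x + y - l) hlx hly (by linarith) (by linarith)
      (by ring)] at hp'
    exact hp (ofPath_eq_zero_of_mk_eq_comp k hp' fun hl => by linarith [hl.2])

theorem exists_lift_of_mem_span {x y ℓ : ℝ} {S : Set ℝ} (hℓ : ℓ ∉ S) {𝕀 : Set ℝ}
    {f : pt k 𝕀 x ⟶ pt k 𝕀 y}
    (hf : f ∈ Submodule.span k {g | ∃ ℓ' ∈ S, IsPathLike g ℓ'}) :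
    ∃ g : LambdaReal.pt k x ⟶ LambdaReal.pt k y,
      (Quotient.functor (LambdaReal.outsideRel k 𝕀)).map g = f ∧
        LambdaReal.lengthCoeff k ℓ g = 0 := by
  induction hf using Submodule.span_induction with
  | zero => exact ⟨0, Functor.map_zero _ _ _, map_zero _⟩
  | add a b _ _ ha hb =>
    obtain ⟨a, rfl, ha⟩ := ha
    obtain ⟨b, rfl, hb⟩ := hb
    exact ⟨a + b, Functor.map_add _, by rw [map_add, ha, hb, add_zero]⟩
  | smul c a _ ha =>
    obtain ⟨a, rfl, ha⟩ := ha
    exact ⟨c • a, rfl, by rw [map_smul, ha, smul_zero]⟩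
  | mem f hf =>
    obtain ⟨ℓ', hℓ', -, p, rfl, rfl⟩ := hf
    refine ⟨_, rfl, LambdaReal.lengthCoeff_of_ne k fun h => hℓ ?_⟩
    rw [← h]
    exact hℓ'

/-- The functional `lengthCoeff` at the length of `p` separates `p` from all other lengths. The case
`S = ∅` says that `p` is nonzero; for `S = Set.Ici (f y)` the lemma bounds the lengths occurring in
`D_f`. -/
theorem ofPath_notMem_span {x y : ℝ} {p : RealPath x y} {S : Set ℝ} (hS : RealPath.len p ∉ S)
    (h₀ : RealPath.len p < x + y) (h₁ : RealPath.len p < 2 - x - y) :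
    ofPath k (Set.Ioo 0 1) p ∉ Submodule.span k {g | ∃ ℓ' ∈ S, IsPathLike g ℓ'} := by
  intro hf
  obtain ⟨g, hg, hg0⟩ := exists_lift_of_mem_span k hS hf
  have h1 := (Quotient.functor_map_eq_iff _ _ _).1 hg
  have h2 := LambdaReal.lengthCoeff_outsideIdeal k h₀ h₁ h1
  rw [map_sub, hg0, LambdaReal.lengthCoeff_of_eq k (RealPreproj.length_mk p), zero_sub] at h2
  exact one_ne_zero (neg_eq_zero.1 h2)

end LambdaCat

theorem picture_decorousSubmod (k : Type*) [Field k] {a : ℝ} {f : ℝ → ℝ}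
    (hf : IsBoundaryFunction a f) : (decorousSubmod k hf).picture =
      {q | |a - q.1| ≤ q.2 ∧ q.2 < a + q.1 ∧ q.2 < 2 - a - q.1 ∧ f q.1 ≤ q.2} := by
  have hset : ∀ y : ℝ, (decorousSubmod k hf).carrier y =
      Submodule.span k {g | ∃ ℓ ∈ Set.Ici (f y), LambdaCat.IsPathLike g ℓ} := by
    intro y
    refine congrArg (Submodule.span k) (Set.ext fun g => ?_)
    exact exists_congr fun ℓ => and_comm
  ext ⟨y, ℓ⟩
  change (∃ g ∈ (decorousSubmod k hf).carrier y, LambdaCat.IsPathLike (y := y) g ℓ) ↔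
    |a - y| ≤ ℓ ∧ ℓ < a + y ∧ ℓ < 2 - a - y ∧ f y ≤ ℓ
  rw [hset]
  constructor
  · rintro ⟨_, hg, hg0, p, rfl, rfl⟩
    obtain ⟨h₀, h₁⟩ := LambdaCat.len_lt_of_ofPath_ne_zero k hg0
    refine ⟨RealPath.abs_sub_le_len p, h₀, h₁, ?_⟩
    by_contra h
    exact LambdaCat.ofPath_notMem_span k h h₀ h₁ hg
  · rintro ⟨h, h₀, h₁, h₂⟩
    obtain ⟨p, rfl⟩ := RealPath.exists_len_eq h
    have hp : LambdaCat.IsPathLike (LambdaCat.ofPath k (Set.Ioo 0 1) p) (RealPath.len p) := by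
      refine ⟨fun h0 => ?_, p, rfl, rfl⟩
      refine LambdaCat.ofPath_notMem_span k (S := ∅) (Set.notMem_empty _) h₀ h₁ ?_
      rw [h0]
      exact zero_mem _
    exact ⟨_, Submodule.subset_span ⟨_, h₂, hp⟩, hp⟩

theorem mem_drawnSquare_iff {a b r : ℝ} {p : ℝ × ℝ} :
    p ∈ drawnSquare a b r ↔ b - r + |p.1 - a| ≤ p.2 ∧ p.2 < b + r - |p.1 - a| := by
  change |p.1 - a| + |p.2 - b| ≤ r ∧ ¬ (b ≤ p.2 ∧ |p.1 - a| + |p.2 - b| = r) ↔ _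
  rcases le_or_gt b p.2 with h | h
  · rw [abs_of_nonneg (sub_nonneg.2 h)]
    constructor
    · rintro ⟨h₁, h₂⟩
      have h₃ := lt_of_le_of_ne h₁ fun h₃ => h₂ ⟨h, h₃⟩
      constructor <;> linarith
    · rintro ⟨h₁, h₂⟩
      exact ⟨by linarith, fun h₃ => by linarith [h₃.2]⟩
  · rw [abs_of_neg (sub_neg.2 h)]
    constructor
    · rintro ⟨h₁, -⟩
      constructor <;> linarith
    · rintro ⟨h₁, h₂⟩
      exact ⟨by linarith, fun h₃ => by linarith [h₃.1]⟩

/-! ### The boundary function of `γ_w` at grid points. -/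

namespace Permuton

theorem corner_eq_prod (x y : unitInterval) : corner x y = Set.Icc 0 x ×ˢ Set.Icc 0 y := by
  ext p
  exact ⟨fun hp => ⟨⟨p.1.2.1, hp.1⟩, ⟨p.2.2.1, hp.2⟩⟩, fun hp => ⟨hp.1.2, hp.2.2⟩⟩

theorem volume_strip_inter_grid {n : ℕ} (j : Fin n) {q : ℕ} (t : unitInterval)
    (ht : (t : ℝ) = q / n) :
    volume (Set.Icc 0 t ∩ strip n j) = if j.val < q then (n : ENNReal)⁻¹ else 0 := by
  have hn : (0 : ℝ) < n := by exact_mod_cast j.pos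
  rw [volume_strip_inter, ht]
  split_ifs with h
  · rw [min_eq_right (by gcongr; omega), min_eq_right (by gcongr), ← sub_div]
    push_cast
    rw [add_sub_cancel_left, one_div, ENNReal.ofReal_inv_of_pos hn, ENNReal.ofReal_natCast]
  · rw [min_eq_left (by gcongr; omega), min_eq_left (by gcongr; omega), sub_self,
      ENNReal.ofReal_zero]

theorem ofPerm_measureReal_corner {m : ℕ} (w : Equiv.Perm (Fin (m + 1))) {p q : ℕ}
    (hp : p ≤ m + 1) (hq : q ≤ m + 1) :
    (ofPerm w).measure.real (corner (p / (m + 1 : ℕ)) (q / (m + 1 : ℕ))) =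
      cornerCount w q p / (m + 1 : ℕ) := by
  have hn : (0 : ℝ) < (m + 1 : ℕ) := by positivity
  have hmem : ∀ {q : ℕ}, q ≤ m + 1 → (q / (m + 1 : ℕ) : ℝ) ∈ unitInterval := fun {q} hq =>
    ⟨by positivity, (div_le_one hn).2 (by exact_mod_cast hq)⟩
  have hcorner := corner_eq_prod ⟨_, hmem hp⟩ ⟨_, hmem hq⟩
  -- `cornerCount` runs over the values of `w`, the measure over its arguments; `w⁻¹` reindexes.
  have hcard : cornerCount w q p =
      (Finset.univ.filter fun j : Fin (m + 1) => j.val < p ∧ (w j).val < q).card := by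
    rw [cornerCount]
    refine Finset.card_bij (fun i _ => w⁻¹ i) ?_ (fun _ _ _ _ h => w⁻¹.injective h) ?_
    · intro i hi
      rw [Finset.mem_filter_univ] at hi ⊢
      simpa [and_comm] using hi
    · intro j hj
      rw [Finset.mem_filter_univ] at hj
      exact ⟨w j, by rw [Finset.mem_filter_univ]; simpa [and_comm] using hj, by simp⟩
  have h : (ofPerm w).measure (corner (p / (m + 1 : ℕ)) (q / (m + 1 : ℕ))) =
      cornerCount w q p * ((m + 1 : ℕ) : ENNReal)⁻¹ := by
    change ofPermMeasure w _ = _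
    simp only at hcorner
    rw [hcorner, ofPermMeasure, Measure.finsetSum_apply, hcard, Finset.card_filter, Nat.cast_sum,
      Finset.sum_mul]
    refine Finset.sum_congr rfl fun j _ => ?_
    rw [Measure.smul_apply, Measure.restrict_apply (measurableSet_Icc.prod measurableSet_Icc),
      Set.prod_inter_prod, Measure.volume_eq_prod, Measure.prod_prod,
      volume_strip_inter_grid j _ rfl, volume_strip_inter_grid (w j) _ rfl, smul_eq_mul]
    by_cases h1 : j.val < p
    · by_cases h2 : (w j).val < q
      · rw [if_pos h1, if_pos h2, if_pos ⟨h1, h2⟩, ← mul_assoc,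
          ENNReal.mul_inv_cancel (by simp) (by simp), Nat.cast_one]
      · simp [h2]
    · simp [h1]
  rw [measureReal_def, h, ENNReal.toReal_mul, ENNReal.toReal_inv, ENNReal.toReal_natCast,
    ENNReal.toReal_natCast, div_eq_mul_inv]

theorem ofPerm_boundary {m : ℕ} (w : Equiv.Perm (Fin (m + 1))) {p q : ℕ}
    (hp : p ≤ m + 1) (hq : q ≤ m + 1) :
    (ofPerm w).boundary (q / (m + 1 : ℕ)) (p / (m + 1 : ℕ)) =
      (q + p - 2 * cornerCount w q p) / (m + 1 : ℕ) := by
  rw [boundary, ofPerm_measureReal_corner w hp hq]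
  ring

end Permuton

/-! ### Comparison of the two pictures. -/

theorem abs_sub_le_mul_boundary {n : ℕ} (hn : 0 < n) {a : ℝ} {f : ℝ → ℝ}
    (hf : IsBoundaryFunction a f) {X U : ℝ} (hX : 0 ≤ X ∧ X ≤ n) (hU : 0 ≤ U ∧ U ≤ n) :
    |n * f (X / n) - n * f (U / n)| ≤ |X - U| := by
  have hn' : (0 : ℝ) < n := by exact_mod_cast hn
  have h := hf.lipschitz (U / n) ⟨by have := hU.1; positivity, (div_le_one hn').2 hU.2⟩
    (X / n) ⟨by have := hX.1; positivity, (div_le_one hn').2 hX.2⟩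
  rwa [← sub_div, abs_div, abs_of_pos hn', le_div_iff₀ hn', mul_comm, ← abs_of_pos hn', ← abs_mul,
    abs_of_pos hn', mul_sub] at h

/-- Let `n = m + 1`, let `w` be a permutation of `n` elements, given by a reduced expression, and let
`i` be a vertex of the Dynkin diagram of type `A_{n-1}`. The picture of the summand at `i / n` of the
permuton ideal of `γ_w` is the picture of the radical filtration of the summand at `i` of the
permutation ideal `I_w`. -/
theorem mainTheorem5 (k : Type*) [Field k] (m : ℕ) (w : Equiv.Perm (Fin (m + 1)))
    (word : List (Fin m)) (hword : IsReducedExpression word w) (i : Fin m) :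
    ((Permuton.ofPerm w).ideal k (vertexPoint i)).picture =
      radicalPicture k (PreprojAlg.permutationIdeal k word) i := by
  rw [Permuton.ideal, picture_decorousSubmod]
  have hf := (Permuton.ofPerm w).isBoundaryFunction (vertexPoint i).2
  have hlip := fun X U : ℝ => abs_sub_le_mul_boundary (n := m + 1) m.succ_pos hf (X := X) (U := U)
  have hn : (0 : ℝ) < (m + 1 : ℕ) := by positivity
  have hi : (vertexPoint i : ℝ) = ((i : ℕ) + 1 : ℝ) / (m + 1 : ℕ) := rfl
  have hgrid : ∀ u : Fin m, (m + 1 : ℕ) * (Permuton.ofPerm w).boundary (vertexPoint i)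
      (((u : ℕ) + 1 : ℝ) / (m + 1 : ℕ)) =
        (i + 1) + (u + 1) - 2 * cornerCount w (i + 1) (u + 1) := by
    intro u
    have h := Permuton.ofPerm_boundary w (p := u + 1) (q := i + 1) (by omega) (by omega)
    rw [Nat.cast_add_one i.val, Nat.cast_add_one u.val] at h
    rw [hi, h, mul_div_cancel₀ _ hn.ne']
  set f := (Permuton.ofPerm w).boundary (vertexPoint i)
  have hnm : ((m + 1 : ℕ) : ℝ) = m + 1 := by push_cast; rfl
  have him : (i : ℝ) + 1 ≤ m := by exact_mod_cast i.2
  ext ⟨x, y⟩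
  obtain ⟨X, rfl⟩ : ∃ X : ℝ, x = X / (m + 1 : ℕ) := ⟨x * (m + 1 : ℕ), by field_simp⟩
  obtain ⟨Y, rfl⟩ : ∃ Y : ℝ, y = Y / (m + 1 : ℕ) := ⟨y * (m + 1 : ℕ), by field_simp⟩
  have hleft : (X / (m + 1 : ℕ), Y / (m + 1 : ℕ)) ∈ {q : ℝ × ℝ | |(vertexPoint i : ℝ) - q.1| ≤ q.2 ∧
      q.2 < vertexPoint i + q.1 ∧ q.2 < 2 - vertexPoint i - q.1 ∧ f q.1 ≤ q.2} ↔
      |(i : ℝ) + 1 - X| ≤ Y ∧ Y < i + 1 + X ∧ Y < 2 * (m + 1) - (i + 1) - X ∧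
        (m + 1 : ℕ) * f (X / (m + 1 : ℕ)) ≤ Y := by
    rw [Set.mem_ofPred_eq]
    simp only
    refine and_congr ?_ (and_congr ?_ (and_congr ?_ ?_))
    · rw [hi, ← sub_div, abs_div, abs_of_pos hn, div_le_div_iff_of_pos_right hn]
    · rw [hi, ← add_div, div_lt_div_iff_of_pos_right hn]
    · rw [show (2 : ℝ) - vertexPoint i - X / (m + 1 : ℕ) =
          (2 * (m + 1) - (i + 1) - X) / (m + 1 : ℕ) by rw [hi, hnm]; field_simp,
        div_lt_div_iff_of_pos_right hn]
    · rw [le_div_iff₀ hn, mul_comm]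
  have hsquare : ∀ (u : Fin m) (d : ℕ), (X / (m + 1 : ℕ), Y / (m + 1 : ℕ)) ∈
      drawnSquare (((u : ℕ) + 1 : ℝ) / (m + 1 : ℕ)) (((d : ℕ) + 1 : ℝ) / (m + 1 : ℕ))
        (1 / (m + 1 : ℕ)) ↔ d + |X - (u + 1)| ≤ Y ∧ Y < d + 2 - |X - (u + 1)| := by
    intro u d
    rw [mem_drawnSquare_iff]
    simp only
    rw [← sub_div, ← sub_div, ← add_div, abs_div, abs_of_pos hn, ← add_div, ← sub_div,
      div_le_div_iff_of_pos_right hn, div_lt_div_iff_of_pos_right hn]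
    ring_nf
  rw [hleft, radicalPicture]
  simp only [Set.mem_iUnion, exists_prop, PreprojAlg.hasFactor_permutationIdeal_iff k hword,
    hsquare]
  clear hleft hsquare
  constructor
  · rintro ⟨h₁, h₂, h₃, h₄⟩
    rw [abs_le] at h₁
    -- In the rotated coordinates `Y - X + (i + 1)` and `X + Y - (i + 1)` the squares are products
    -- of half-open intervals of length `2`, so the floors give the path whose square contains the
    -- point.
    have hb := Nat.floor_le (show 0 ≤ (Y - X + (i + 1)) / 2 by linarith)
    have hb' := Nat.lt_floor_add_one ((Y - X + (i + 1)) / 2)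
    have ha := Nat.floor_le (show 0 ≤ (X + Y - (i + 1)) / 2 by linarith)
    have ha' := Nat.lt_floor_add_one ((X + Y - (i + 1)) / 2)
    set b := ⌊(Y - X + (i + 1)) / 2⌋₊
    set a := ⌊(X + Y - (i + 1)) / 2⌋₊
    have hbi : b < i.val + 1 := by
      have : (b : ℝ) < i + 1 := by linarith
      exact_mod_cast this
    have hai : a + i.val < m := by
      have : (a + i : ℝ) < m := by linarith
      exact_mod_cast this
    obtain ⟨u, hu⟩ : ∃ u : Fin m, i.val + a = u.val + b :=
      ⟨⟨i.val + a - b, by omega⟩, by simp only; omega⟩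
    have hu' : (i + a : ℝ) = u + b := by exact_mod_cast hu
    have h₅ : |X - (u + 1)| ≤ Y - (a + b) := by rw [abs_le]; constructor <;> linarith
    have h₆ : |X - (u + 1)| < a + b + 2 - Y := by rw [abs_lt]; constructor <;> linarith
    refine ⟨u, a + b, ⟨a, b, rfl, hu, by omega, by omega, ?_⟩, ?_, ?_⟩
    -- If the path were not in `I_w`, the boundary at its grid point would exceed `a + b`, hence be
    -- at least `a + b + 2` by parity. The Lipschitz bound then puts the whole square above the
    -- graph.
    · by_contra hc
      have hc' : (a + cornerCount w (i + 1) (u + 1) : ℝ) ≤ u := by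
        exact_mod_cast (show a + cornerCount w (i + 1) (u + 1) ≤ u by omega)
      have hum : (u : ℝ) + 1 ≤ m := by exact_mod_cast u.2
      have h := hlip X (u + 1) (by rw [hnm]; constructor <;> linarith)
        (by rw [hnm]; constructor <;> linarith [(Nat.cast_nonneg u.val : (0 : ℝ) ≤ u.val)])
      rw [hgrid] at h
      have := neg_abs_le ((m + 1 : ℕ) * f (X / (m + 1 : ℕ)) -
        ((i + 1) + (u + 1) - 2 * cornerCount w (i + 1) (u + 1)))
      linarith
    · push_cast; linarith
    · push_cast; linarith
  · rintro ⟨u, d, ⟨a, b, rfl, hu, hau, hbu, hc⟩, h₁, h₂⟩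
    have hu' : (i + a : ℝ) = u + b := by exact_mod_cast hu
    have hau' : (a : ℝ) ≤ u := by exact_mod_cast hau
    have hbu' : (b + u + 1 : ℝ) ≤ m := by exact_mod_cast hbu
    have hc' : (u + 1 : ℝ) ≤ a + cornerCount w (i + 1) (u + 1) := by exact_mod_cast hc
    have ha0 : (0 : ℝ) ≤ a := Nat.cast_nonneg a
    have hb0 : (0 : ℝ) ≤ b := Nat.cast_nonneg b
    push_cast at h₁ h₂
    have h₃ := neg_abs_le (X - (u + 1))
    have h₄ := le_abs_self (X - (u + 1))
    refine ⟨?_, ?_, ?_, ?_⟩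
    · rw [abs_le]; constructor <;> linarith
    · linarith
    · linarith
    -- Here the boundary at the grid point is at most `a + b`, so by the Lipschitz bound it is at
    -- most `a + b + |X - (u + 1)| ≤ Y` at `X`.
    · have h := hlip X (u + 1) (by rw [hnm]; constructor <;> linarith)
        (by rw [hnm]; constructor <;> linarith)
      rw [hgrid] at h
      have := le_abs_self ((m + 1 : ℕ) * f (X / (m + 1 : ℕ)) -
        ((i + 1) + (u + 1) - 2 * cornerCount w (i + 1) (u + 1)))
      linarith
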